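/- Let $X$ be a finite-dimensional Noetherian separated scheme (for example over a field), and let $\mathcal{U}=\{U_h\}_{h\in H}$ be an open affine covering of $X$. Let $\mathcal{N}$ be its nerve, i.e. the set of finite nonempty subsets $\alpha=\{h_0,\dots,h_k\}\subseteq H$ with $U_\alpha:=U_{h_0}\cap\dots\cap U_{h_k}\neq\emptyset$, partially ordered by inclusion, and put $A_\alpha=\Gamma(U_\alpha,\mathcal{O}_X)$, so that for $\alpha\le\beta$ there is a restriction map $A_\alpha\to A_\beta$. Let $\operatorname{DGMod}(R)$ denote the category of unbounded cochain complexes of $R$-modules. An $A_{\boldsymbol{\cdot}}$-module $\mathcal{F}$ consists of objects $\mathcal{F}_\alpha\in\operatorname{DGMod}(A_\alpha)$ for $\alpha\in\mathcal{N}$ and morphisms $f_{\alpha\beta}\colon\mathcal{F}_\alpha\otimes_{A_\alpha}A_\beta\to\mathcal{F}_\beta$ in $\operatorname{DGMod}(A_\beta)$ for $\alpha\le\beta$, with $f_{\alpha\alpha}$ the canonical isomorphism $\mathcal{F}_\alpha\otimes_{A_\alpha}A_\alpha\cong\mathcal{F}_\alpha$ and $f_{\beta\gamma}\circ(f_{\alpha\beta}\otimes_{A_\beta}A_\gamma)=f_{\alpha\gamma}$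 for $\alpha\le\beta\le\gamma$. A morphism $\varphi\colon\mathcal{F}\to\mathcal{G}$ is a family of morphisms $\varphi_\alpha\colon\mathcal{F}_\alpha\to\mathcal{G}_\alpha$ in $\operatorname{DGMod}(A_\alpha)$ with $g_{\alpha\beta}\circ(\varphi_\alpha\otimes_{A_\alpha} A_\beta)=\varphi_\beta\circ f_{\alpha\beta}$ for $\alpha\le\beta$. Let $\mathbf{Mod}(A_{\boldsymbol{\cdot}})$ be the resulting category. The latching module of $\mathcal{F}$ at $\alpha$ is $L_\alpha\mathcal{F}=\operatorname{colim}_{\gamma<\alpha}(\mathcal{F}_\gamma\otimes_{A_\gamma}A_\alpha)$; it comes with a natural map $L_\alpha\mathcal{F}\to\mathcal{F}_\alpha$. A morphism in $\operatorname{DGMod}(R)$ is a cofibration if it has the left lifting property with respect to all degreewise surjective quasi-isomorphisms, i.e. if it is a cofibration of the projective model structure. Theorem. The category $\mathbf{Mod}(A_{\boldsymbol{\cdot}})$ has all small limits and colimits, and it carries a model structure, with functorial factorizations, in which a morphism $\varphi\colon\mathcal{F}\to\mathcal{G}$ is 1. a weak equivalence if and only if $\varphi_\alpha\colon\mathcal{F}_\alpha\to\mathcal{G}_\alpha$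 is a quasi-isomorphism for every $\alpha\in\mathcal{N}$; 2. a fibration if and only if $\varphi_\alpha\colon\mathcal{F}_\alpha\to\mathcal{G}_\alpha$ is surjective in each degree for every $\alpha\in\mathcal{N}$; 3. a cofibration if and only if the natural morphism $L_\alpha\mathcal{G}\amalg_{L_\alpha\mathcal{F}}\mathcal{F}_\alpha\to\mathcal{G}_\alpha$ is a cofibration in $\operatorname{DGMod}(A_\alpha)$ for every $\alpha\in\mathcal{N}$. -/

import Mathlib

open CategoryTheory CategoryTheory.Limits AlgebraicGeometry HomotopicalAlgebra

universe u

noncomputable section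

/-- Unbounded cochain complexes of `R`-modules, i.e. DG-modules over the commutative ring `R`. -/
abbrev DGMod (R : CommRingCat.{u}) : Type (u + 1) := CochainComplex (ModuleCat.{u} R) ℤ

namespace DGMod

section Modules

variable {R S T T' : Type u} [CommRing R] [CommRing S] [CommRing T] [CommRing T']

/-- Extension of scalars of modules along a homomorphism of commutative rings. -/
abbrev ext₀ (f : R →+* S) : ModuleCat.{u} R ⥤ ModuleCat.{u} S :=
  ModuleCat.extendScalars.{u, u, u} f

/-- `M ⊗_R R ≅ M`. -/
def extIdIso (f : R →+* R) (e : f = RingHom.id R) (M : ModuleCat.{u} R) : (ext₀ f).obj M ≅ M :=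
  eqToIso (by rw [e]) ≪≫ (ModuleCat.extendScalarsId R).app M

/-- `M ⊗_R T ≅ (M ⊗_R S) ⊗_S T` for ring homomorphisms `R → S → T` with composition `h`. -/
def extCompIso (f : R →+* S) (g : S →+* T) (h : R →+* T) (e : g.comp f = h)
    (M : ModuleCat.{u} R) :
    (ext₀ h).obj M ≅ (ext₀ g).obj ((ext₀ f).obj M) :=
  eqToIso (by rw [← e]) ≪≫ (ModuleCat.extendScalarsComp f g).app M

lemma extIdIso_naturality (f : R →+* R) (e : f = RingHom.id R)
    {M M' : ModuleCat.{u} R} (a : M ⟶ M') :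
    (ext₀ f).map a ≫ (extIdIso f e M').hom = (extIdIso f e M).hom ≫ a := by
  subst e
  simp only [extIdIso, eqToIso_refl, Iso.refl_trans]
  exact (ModuleCat.extendScalarsId R).hom.naturality a

lemma extCompIso_naturality (f : R →+* S) (g : S →+* T) (h : R →+* T) (e : g.comp f = h)
    {M M' : ModuleCat.{u} R} (a : M ⟶ M') :
    (ext₀ h).map a ≫ (extCompIso f g h e M').hom =
      (extCompIso f g h e M).hom ≫ (ext₀ g).map ((ext₀ f).map a) := by
  subst e
  simp only [extCompIso, eqToIso_refl, Iso.refl_trans]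
  exact (ModuleCat.extendScalarsComp f g).hom.naturality a

lemma extCompIso_id (f : R →+* R) (g : R →+* S) (e : f = RingHom.id R) (e' : g.comp f = g)
    (M : ModuleCat.{u} R) :
    (extCompIso f g g e' M).hom ≫ (ext₀ g).map (extIdIso f e M).hom = 𝟙 _ := by
  subst e
  have := NatTrans.congr_app (ModuleCat.extendScalars_id_comp g) M
  simp only [NatTrans.comp_app, Functor.whiskerRight_app, Functor.leftUnitor_hom_app,
    NatTrans.id_app] at this
  simp only [extCompIso, extIdIso, eqToIso_refl, Iso.refl_trans]
  exact this

lemma extCompIso_assoc (f : R →+* S) (g : S →+* T) (k : T →+* T') (fg : R →+* T) (gk : S →+* T')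
    (fgk : R →+* T') (e₁ : g.comp f = fg) (e₂ : k.comp g = gk) (e₃ : k.comp fg = fgk)
    (e₄ : gk.comp f = fgk) (M : ModuleCat.{u} R) :
    (extCompIso fg k fgk e₃ M).hom ≫ (ext₀ k).map (extCompIso f g fg e₁ M).hom =
      (extCompIso f gk fgk e₄ M).hom ≫ (extCompIso g k gk e₂ ((ext₀ f).obj M)).hom := by
  subst e₁ e₂ e₃
  have := NatTrans.congr_app (ModuleCat.extendScalars_assoc f g k) M
  simp only [NatTrans.comp_app, Functor.whiskerRight_app, Functor.whiskerLeft_app,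
    Functor.associator_inv_app] at this
  simp only [extCompIso, eqToIso_refl, Iso.refl_trans]
  exact this

instance (f : R →+* S) : (ModuleCat.extendScalars.{u, u, u} f).Additive :=
  (ModuleCat.extendRestrictScalarsAdj.{u, u, u} f).left_adjoint_additive

end Modules

section Complexes

variable {R S T T' : CommRingCat.{u}}

lemma hom_eq_id {f : R ⟶ R} (e : f = 𝟙 R) : f.hom = RingHom.id R := by
  rw [e, CommRingCat.hom_id]

lemma hom_comp_eq {f : R ⟶ S} {g : S ⟶ T} {h : R ⟶ T} (e : f ≫ g = h) :
    g.hom.comp f.hom = h.hom := by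
  rw [← e, CommRingCat.hom_comp]

/-- Extension of scalars `- ⊗_R S : DGMod R ⥤ DGMod S`, in each degree. -/
def extend (f : R ⟶ S) : DGMod R ⥤ DGMod S :=
  (ext₀ f.hom).mapHomologicalComplex _

/-- `M ⊗_R R ≅ M` for complexes. -/
def extendId (f : R ⟶ R) (e : f = 𝟙 R) (M : DGMod R) : (extend f).obj M ≅ M :=
  HomologicalComplex.Hom.isoOfComponents (fun n => extIdIso f.hom (hom_eq_id e) (M.X n))
    (fun _ _ _ => (extIdIso_naturality f.hom (hom_eq_id e) _).symm)

/-- `M ⊗_R T ≅ (M ⊗_R S) ⊗_S T` for complexes. -/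
def extendComp (f : R ⟶ S) (g : S ⟶ T) (h : R ⟶ T) (e : f ≫ g = h) (M : DGMod R) :
    (extend h).obj M ≅ (extend g).obj ((extend f).obj M) :=
  HomologicalComplex.Hom.isoOfComponents (fun n => extCompIso f.hom g.hom h.hom (hom_comp_eq e) (M.X n))
    (fun _ _ _ => (extCompIso_naturality f.hom g.hom h.hom (hom_comp_eq e) _).symm)

lemma extendComp_naturality (f : R ⟶ S) (g : S ⟶ T) (h : R ⟶ T) (e : f ≫ g = h)
    {M M' : DGMod R} (a : M ⟶ M') :
    (extend h).map a ≫ (extendComp f g h e M').hom =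
      (extendComp f g h e M).hom ≫ (extend g).map ((extend f).map a) := by
  ext1 n
  exact extCompIso_naturality f.hom g.hom h.hom (hom_comp_eq e) (a.f n)

lemma extendComp_id (f : R ⟶ R) (g : R ⟶ S) (e : f = 𝟙 R) (e' : f ≫ g = g) (M : DGMod R) :
    (extendComp f g g e' M).hom ≫ (extend g).map (extendId f e M).hom = 𝟙 _ := by
  ext1 n
  exact extCompIso_id f.hom g.hom (hom_eq_id e) (hom_comp_eq e') (M.X n)

lemma extendComp_assoc (f : R ⟶ S) (g : S ⟶ T) (k : T ⟶ T') (fg : R ⟶ T) (gk : S ⟶ T')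
    (fgk : R ⟶ T') (e₁ : f ≫ g = fg) (e₂ : g ≫ k = gk) (e₃ : fg ≫ k = fgk) (e₄ : f ≫ gk = fgk)
    (M : DGMod R) :
    (extendComp fg k fgk e₃ M).hom ≫ (extend k).map (extendComp f g fg e₁ M).hom =
      (extendComp f gk fgk e₄ M).hom ≫ (extendComp g k gk e₂ ((extend f).obj M)).hom := by
  ext1 n
  exact extCompIso_assoc f.hom g.hom k.hom fg.hom gk.hom fgk.hom (hom_comp_eq e₁) (hom_comp_eq e₂)
    (hom_comp_eq e₃) (hom_comp_eq e₄) (M.X n)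

lemma extendComp_comp (f : R ⟶ S) (g : S ⟶ T) (k : T ⟶ T') (fg : R ⟶ T) (gk : S ⟶ T')
    (fgk : R ⟶ T') (e₁ : f ≫ g = fg) (e₂ : g ≫ k = gk) (e₃ : fg ≫ k = fgk) (e₄ : f ≫ gk = fgk)
    {M : DGMod R} {M' : DGMod S} {M'' : DGMod T} (a : (extend f).obj M ⟶ M')
    (b : (extend g).obj M' ⟶ M'') :
    (extendComp fg k fgk e₃ M).hom ≫
      (extend k).map ((extendComp f g fg e₁ M).hom ≫ (extend g).map a ≫ b) =
    ((extendComp f gk fgk e₄ M).hom ≫ (extend gk).map a) ≫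
      (extendComp g k gk e₂ M').hom ≫ (extend k).map b := by
  rw [Functor.map_comp, Functor.map_comp, ← Category.assoc,
    extendComp_assoc f g k fg gk fgk e₁ e₂ e₃ e₄ M]
  simp only [Category.assoc]
  rw [← Category.assoc ((extend gk).map a), extendComp_naturality, Category.assoc]

end Complexes

/-- The property that a morphism of DG-modules is surjective in each degree: the fibrations of
the projective model structure. -/
def fib (R : CommRingCat.{u}) : MorphismProperty (DGMod R) :=
  fun _ _ p => ∀ n : ℤ, Function.Surjective (p.f n)

/-- The cofibrations of the projective model structure on DG-modules: the morphisms with the left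
lifting property with respect to all degreewise surjective quasi-isomorphisms. -/
def cof (R : CommRingCat.{u}) : MorphismProperty (DGMod R) :=
  (fib R ⊓ HomologicalComplex.quasiIso (ModuleCat.{u} R) (ComplexShape.up ℤ)).llp

end DGMod

/-- A module over a diagram `A` of commutative rings indexed by a category `N`: a DG-module
`F_α` over `A_α` for each `α`, and `A_β`-linear morphisms of complexes
`f_{αβ} : F_α ⊗_{A_α} A_β ⟶ F_β`, normalised for identities and satisfying the cocycle condition
`f_{βγ} ∘ (f_{αβ} ⊗ A_γ) = f_{αγ}`. -/
structure DiagMod {N : Type u} [SmallCategory N] (A : N ⥤ CommRingCat.{u}) where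
  obj (α : N) : DGMod (A.obj α)
  map {α β : N} (s : α ⟶ β) : (DGMod.extend (A.map s)).obj (obj α) ⟶ obj β
  map_id (α : N) : map (𝟙 α) = (DGMod.extendId (A.map (𝟙 α)) (A.map_id α) (obj α)).hom
  map_comp {α β γ : N} (s : α ⟶ β) (t : β ⟶ γ) :
    map (s ≫ t) =
      (DGMod.extendComp (A.map s) (A.map t) (A.map (s ≫ t)) (A.map_comp s t).symm
        (obj α)).hom ≫ (DGMod.extend (A.map t)).map (map s) ≫ map t

namespace DiagMod

section

variable {N : Type u} [SmallCategory N] {A : N ⥤ CommRingCat.{u}}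

/-- A morphism of modules over a diagram of rings: morphisms `φ_α` of DG-modules over `A_α` with
`g_{αβ} ∘ (φ_α ⊗ A_β) = φ_β ∘ f_{αβ}`. -/
@[ext]
structure Hom (F G : DiagMod A) where
  app (α : N) : F.obj α ⟶ G.obj α
  naturality {α β : N} (s : α ⟶ β) :
    (DGMod.extend (A.map s)).map (app α) ≫ G.map s = F.map s ≫ app β

instance : Category (DiagMod A) where
  Hom := Hom
  id F := { app := fun α => 𝟙 (F.obj α), naturality := by simp }
  comp φ ψ :=
    { app := fun α => φ.app α ≫ ψ.app α
      naturality := fun s => by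
        rw [Functor.map_comp, Category.assoc, ψ.naturality, ← Category.assoc, φ.naturality,
          Category.assoc] }
  id_comp φ := Hom.ext (by funext α; exact Category.id_comp _)
  comp_id φ := Hom.ext (by funext α; exact Category.comp_id _)
  assoc φ ψ χ := Hom.ext (by funext α; exact Category.assoc _ _ _)

end

/-! ### Latching objects, for a diagram of rings indexed by a partially ordered set -/

section

variable {N : Type u} [PartialOrder N] {A : N ⥤ CommRingCat.{u}}

lemma map_homOfLE_comp (A : N ⥤ CommRingCat.{u}) {γ δ ε : N} (h₁ : γ ≤ δ) (h₂ : δ ≤ ε) :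
    A.map (homOfLE h₁) ≫ A.map (homOfLE h₂) = A.map (homOfLE (h₁.trans h₂)) :=
  (A.map_comp (homOfLE h₁) (homOfLE h₂)).symm

lemma map_homOfLE_trans (F : DiagMod A) {γ δ ε : N} (h₁ : γ ≤ δ) (h₂ : δ ≤ ε) :
    F.map (homOfLE (h₁.trans h₂)) =
      (DGMod.extendComp _ _ _ (map_homOfLE_comp A h₁ h₂) (F.obj γ)).hom ≫
        (DGMod.extend (A.map (homOfLE h₂))).map (F.map (homOfLE h₁)) ≫ F.map (homOfLE h₂) :=
  F.map_comp (homOfLE h₁) (homOfLE h₂)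

lemma map_homOfLE_refl (F : DiagMod A) (γ : N) :
    F.map (homOfLE (le_refl γ)) = (DGMod.extendId _ (A.map_id γ) (F.obj γ)).hom :=
  F.map_id γ

/-- For `γ ≤ δ ≤ α`, the map `F_γ ⊗ A_α ≅ (F_γ ⊗ A_δ) ⊗ A_α ⟶ F_δ ⊗ A_α` given by
`f_{γδ} ⊗ A_α`. -/
def latchingTransition (F : DiagMod A) {γ δ α : N} (h₁ : γ ≤ δ) (h₂ : δ ≤ α) :
    (DGMod.extend (A.map (homOfLE (h₁.trans h₂)))).obj (F.obj γ) ⟶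
      (DGMod.extend (A.map (homOfLE h₂))).obj (F.obj δ) :=
  (DGMod.extendComp _ _ _ (map_homOfLE_comp A h₁ h₂) (F.obj γ)).hom ≫
    (DGMod.extend (A.map (homOfLE h₂))).map (F.map (homOfLE h₁))

lemma latchingTransition_refl (F : DiagMod A) {γ α : N} (h : γ ≤ α) :
    F.latchingTransition (le_refl γ) h = 𝟙 _ := by
  rw [latchingTransition, map_homOfLE_refl]
  exact DGMod.extendComp_id _ _ _ _ _

lemma latchingTransition_trans (F : DiagMod A) {γ δ ε α : N} (h₁ : γ ≤ δ) (h₂ : δ ≤ ε)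
    (h₃ : ε ≤ α) :
    F.latchingTransition (h₁.trans h₂) h₃ =
      F.latchingTransition h₁ (h₂.trans h₃) ≫ F.latchingTransition h₂ h₃ := by
  rw [latchingTransition, map_homOfLE_trans F h₁ h₂]
  exact DGMod.extendComp_comp _ _ _ _ _ _ _ _ _ _ _ _

lemma latchingTransition_map (F : DiagMod A) {γ δ α : N} (h₁ : γ ≤ δ) (h₂ : δ ≤ α) :
    F.latchingTransition h₁ h₂ ≫ F.map (homOfLE h₂) = F.map (homOfLE (h₁.trans h₂)) := by
  rw [map_homOfLE_trans F h₁ h₂, latchingTransition, Category.assoc]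

lemma latchingTransition_naturality {F G : DiagMod A} (φ : F ⟶ G) {γ δ α : N} (h₁ : γ ≤ δ)
    (h₂ : δ ≤ α) :
    F.latchingTransition h₁ h₂ ≫ (DGMod.extend (A.map (homOfLE h₂))).map (φ.app δ) =
      (DGMod.extend (A.map (homOfLE (h₁.trans h₂)))).map (φ.app γ) ≫
        G.latchingTransition h₁ h₂ := by
  rw [latchingTransition, latchingTransition, Category.assoc, ← Functor.map_comp,
    ← φ.naturality, Functor.map_comp, ← Category.assoc, ← DGMod.extendComp_naturality,
    Category.assoc]

/-- The diagram `γ ↦ F_γ ⊗_{A_γ} A_α` of DG-modules over `A_α`, indexed by the `γ < α`. -/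
def latchingDiagram (F : DiagMod A) (α : N) : {γ : N // γ < α} ⥤ DGMod (A.obj α) where
  obj γ := (DGMod.extend (A.map (homOfLE γ.2.le))).obj (F.obj γ)
  map {γ δ} s := F.latchingTransition (leOfHom s : γ.1 ≤ δ.1) δ.2.le
  map_id γ := F.latchingTransition_refl γ.2.le
  map_comp {γ δ ε} s t :=
    F.latchingTransition_trans (leOfHom s : γ.1 ≤ δ.1) (leOfHom t : δ.1 ≤ ε.1) ε.2.le

/-- The latching module `L_α F = colim_{γ < α} F_γ ⊗_{A_γ} A_α`. -/
def latching (F : DiagMod A) (α : N) : DGMod (A.obj α) := colimit (F.latchingDiagram α)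

/-- The natural map `L_α F ⟶ F_α`, given by `f_{γα}` on `F_γ ⊗_{A_γ} A_α`. -/
def latchingMap (F : DiagMod A) (α : N) : F.latching α ⟶ F.obj α :=
  colimit.desc (F.latchingDiagram α)
    { pt := F.obj α
      ι :=
        { app := fun γ => F.map (homOfLE γ.2.le)
          naturality := fun γ δ s =>
            (F.latchingTransition_map (leOfHom s : γ.1 ≤ δ.1) δ.2.le).trans
              (Category.comp_id _).symm } }

/-- The map `L_α φ : L_α F ⟶ L_α G`, given by `φ_γ ⊗ A_α` on `F_γ ⊗_{A_γ} A_α`. -/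
def mapLatching {F G : DiagMod A} (φ : F ⟶ G) (α : N) : F.latching α ⟶ G.latching α :=
  colimMap
    { app := fun γ => (DGMod.extend (A.map (homOfLE γ.2.le))).map (φ.app γ)
      naturality := fun γ δ s =>
        latchingTransition_naturality φ (leOfHom s : γ.1 ≤ δ.1) δ.2.le }

lemma latchingMap_naturality {F G : DiagMod A} (φ : F ⟶ G) (α : N) :
    mapLatching φ α ≫ G.latchingMap α = F.latchingMap α ≫ φ.app α := by
  apply colimit.hom_ext
  intro γ
  have h := φ.naturality (homOfLE γ.2.le)
  dsimp only [mapLatching, latchingMap]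
  erw [ι_colimMap_assoc, colimit.ι_desc, colimit.ι_desc_assoc]
  exact h

/-- The relative latching map `L_α G ⊔_{L_α F} F_α ⟶ G_α`. -/
def relLatchingMap {F G : DiagMod A} (φ : F ⟶ G) (α : N) :
    pushout (mapLatching φ α) (F.latchingMap α) ⟶ G.obj α :=
  pushout.desc (G.latchingMap α) (φ.app α) (latchingMap_naturality φ α)

end

end DiagMod

/-- The nerve of a family of open subsets: the finite nonempty sets of indices such that the
intersection of the corresponding open subsets is nonempty, ordered by inclusion. -/
abbrev CoverNerve {X : Scheme.{u}} {H : Type u} (U : H → X.Opens) : Type u :=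
  {α : Finset H // α.Nonempty ∧ ((α.inf U : X.Opens) : Set X).Nonempty}

/-- The diagram of rings `α ↦ A_α = Γ(U_α, 𝒪_X)` over the nerve, where `U_α` is the intersection
of the `U h` for `h ∈ α`; the transition maps are the restriction maps. -/
def coverDiagram {X : Scheme.{u}} {H : Type u} (U : H → X.Opens) :
    CoverNerve U ⥤ CommRingCat.{u} where
  obj α := X.presheaf.obj (.op (α.1.inf U))
  map {α β} s := X.presheaf.map (homOfLE (Finset.inf_mono (leOfHom s : α.1 ≤ β.1))).op
  map_id α := X.presheaf.map_id _
  map_comp {α β γ} s t := by rw [← X.presheaf.map_comp]; rfl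

end

/-! The model structure is the projective one: weak equivalences and fibrations are tested at each
index, and cofibrations are the maps with the left lifting property against trivial fibrations. By
the adjunction between extension and restriction of scalars, a module amounts to complexes `F_α`
with compatible semilinear restriction maps, so most identities can be checked on elements. Limits
and colimits are computed indexwise; for colimits this works because extension of scalars preserves
them.

The free disk `freeDisk A α n` corepresents the elements of degree `n` at `α`, and its quotient
`sphere A α n` corepresents the cycles. Lifting against `0 ⟶ freeDisk` is therefore surjectivity,
and lifting against `sphereInclusion` is the elementwise criterion `DGMod.trivialFib_iff` for a
surjective quasi-isomorphism. Disks and spheres are finitely presentable, so the small object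
argument yields both functorial factorizations.

What remains is to identify the trivial cofibrations and the cofibrations. Attach to `p : M ⟶ M'`
over `A_α` the module `matching p`, which is `M` at each `γ < α`, `M'` at `α`, and zero elsewhere;
describing it by families over proofs of `γ < α` and `γ ≤ α` avoids case distinctions. A map `F ⟶
matching p` is a compatible pair `L_α F ⟶ M`, `F_α ⟶ M'`. For `p = 𝟙 M` this is the right adjoint of
evaluation at `α`, and it preserves surjections; hence a map lifting against all fibrations lifts
against surjections at each index, which makes it a quasi-isomorphism there (`llp_fib_le_weq`). A
retract argument then identifies the trivial cofibrations (`llp_inf_weq`).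

For a trivial fibration `p`, the map `matching (𝟙 M) ⟶ matching p` is again one, and lifting `φ`
against it solves the lifting problem of the relative latching map against `p`
(`relLatchingMap_of_llp`). Conversely, lifts are built by well-founded recursion: the part built
below `α` is a map out of `L_α G`, and the relative latching map extends it to `α`
(`llp_of_relLatchingMap`). The recursion applies to the nerve because its elements are finite sets.
-/

noncomputable section

namespace DGMod

/-! ### Extension of scalars through the elements `1 ⊗ x` -/

section Unit

variable {R S T : CommRingCat.{u}}

/-- The map `x ↦ 1 ⊗ x` from a complex to its extension of scalars. -/
def unit (f : R ⟶ S) (M : DGMod R) (n : ℤ) : M.X n →ₛₗ[f.hom] ((extend f).obj M).X n where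
  toFun x := (ModuleCat.extendRestrictScalarsAdj.{u, u, u} f.hom).unit.app (M.X n) x
  map_add' x y := map_add ((ModuleCat.extendRestrictScalarsAdj.{u, u, u} f.hom).unit.app (M.X n)).hom x y
  map_smul' r x :=
    map_smul ((ModuleCat.extendRestrictScalarsAdj.{u, u, u} f.hom).unit.app (M.X n)).hom r x

/-- Extension of scalars is left adjoint to restriction, and a map out of a left adjoint is
determined by its composite with the unit. -/
lemma extend_hom_ext (f : R ⟶ S) {M : DGMod R} {K : DGMod S} {a b : (extend f).obj M ⟶ K}
    (h : ∀ n x, a.f n (unit f M n x) = b.f n (unit f M n x)) : a = b := by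
  ext1 n
  apply ((ModuleCat.extendRestrictScalarsAdj.{u, u, u} f.hom).homEquiv _ _).injective
  ext x
  exact h n x

lemma extend_map_unit (f : R ⟶ S) {M M' : DGMod R} (a : M ⟶ M') (n : ℤ) (x : M.X n) :
    ((extend f).map a).f n (unit f M n x) = unit f M' n (a.f n x) :=
  congr($((ModuleCat.extendRestrictScalarsAdj.{u, u, u} f.hom).unit.naturality (a.f n)) x).symm

lemma extend_d_unit (f : R ⟶ S) (M : DGMod R) (i j : ℤ) (x : M.X i) :
    ((extend f).obj M).d i j (unit f M i x) = unit f M j (M.d i j x) :=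
  congr($((ModuleCat.extendRestrictScalarsAdj.{u, u, u} f.hom).unit.naturality (M.d i j)) x).symm

lemma extendId_unit (f : R ⟶ R) (e : f = 𝟙 R) (M : DGMod R) (n : ℤ) (x : M.X n) :
    (extendId f e M).hom.f n (unit f M n x) = x := by
  subst e
  simp [extendId, extIdIso]
  exact ModuleCat.extendScalarsId_hom_app_one_tmul _ _

lemma extendComp_unit (f : R ⟶ S) (g : S ⟶ T) (h : R ⟶ T) (e : f ≫ g = h) (M : DGMod R) (n : ℤ)
    (x : M.X n) :
    (extendComp f g h e M).hom.f n (unit h M n x) = unit g _ n (unit f M n x) := by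
  subst e
  simp [extendComp, extCompIso]
  exact ModuleCat.extendScalarsComp_hom_app_one_tmul _ _ _ _

/-- The linear map out of an extension of scalars which corresponds to a semilinear map. -/
def ext₀Desc (f : R ⟶ S) {M : ModuleCat.{u} R} {K : ModuleCat.{u} S} (g : M →ₛₗ[f.hom] K) :
    (ext₀ f.hom).obj M ⟶ K :=
  ((ModuleCat.extendRestrictScalarsAdj.{u, u, u} f.hom).homEquiv _ _).symm
    (ModuleCat.ofHom (Y := (ModuleCat.restrictScalars f.hom).obj K)
      { toFun := g, map_add' := map_add g, map_smul' := fun r x => g.map_smulₛₗ r x })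

lemma ext₀Desc_unit (f : R ⟶ S) {M : ModuleCat.{u} R} {K : ModuleCat.{u} S}
    (g : M →ₛₗ[f.hom] K) (x : M) :
    ext₀Desc f g ((ModuleCat.extendRestrictScalarsAdj.{u, u, u} f.hom).unit.app M x) = g x :=
  congr($(((ModuleCat.extendRestrictScalarsAdj.{u, u, u} f.hom).homEquiv _ _).apply_symm_apply
    (ModuleCat.ofHom (Y := (ModuleCat.restrictScalars f.hom).obj K)
      { toFun := g, map_add' := map_add g, map_smul' := fun r x => g.map_smulₛₗ r x })) x)

/-- A morphism of complexes out of an extension of scalars, given by semilinear maps. -/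
def extendDesc (f : R ⟶ S) {M : DGMod R} {K : DGMod S} (g : ∀ n, M.X n →ₛₗ[f.hom] K.X n)
    (hg : ∀ n x, K.d n (n + 1) (g n x) = g (n + 1) (M.d n (n + 1) x)) : (extend f).obj M ⟶ K where
  f n := ext₀Desc f (g n)
  comm' i j hij := by
    obtain rfl : i + 1 = j := hij
    apply ((ModuleCat.extendRestrictScalarsAdj.{u, u, u} f.hom).homEquiv _ _).injective
    ext x
    have h₁ : K.d i (i + 1) (ext₀Desc f (g i) (unit f M i x)) = K.d i (i + 1) (g i x) :=
      congrArg _ (ext₀Desc_unit f (g i) x)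
    have h₂ : ext₀Desc f (g (i + 1)) (((extend f).obj M).d i (i + 1) (unit f M i x)) =
        g (i + 1) (M.d i (i + 1) x) := by
      rw [extend_d_unit]
      exact ext₀Desc_unit f (g (i + 1)) _
    exact h₁.trans ((hg i x).trans h₂.symm)

lemma extendDesc_unit (f : R ⟶ S) {M : DGMod R} {K : DGMod S} (g : ∀ n, M.X n →ₛₗ[f.hom] K.X n)
    (hg : ∀ n x, K.d n (n + 1) (g n x) = g (n + 1) (M.d n (n + 1) x)) (n : ℤ) (x : M.X n) :
    (extendDesc f g hg).f n (unit f M n x) = g n x :=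
  ext₀Desc_unit f (g n) x

end Unit

end DGMod

namespace DiagMod

/-! ### Modules over a diagram as semilinear restriction maps -/

section Elements

variable {N : Type u} [SmallCategory N] {A : N ⥤ CommRingCat.{u}}

/-- The restriction maps `F_α ⟶ F_β` of a module over a diagram of rings. -/
def res (F : DiagMod A) {α β : N} (s : α ⟶ β) (n : ℤ) :
    (F.obj α).X n →ₛₗ[(A.map s).hom] (F.obj β).X n where
  toFun x := (F.map s).f n (DGMod.unit _ _ n x)
  map_add' x y := by simp
  map_smul' r x := by rw [LinearMap.map_smulₛₗ]; exact map_smul ((F.map s).f n).hom _ _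

lemma res_apply (F : DiagMod A) {α β : N} (s : α ⟶ β) (n : ℤ) (x : (F.obj α).X n) :
    F.res s n x = (F.map s).f n (DGMod.unit _ _ n x) := rfl

lemma res_id (F : DiagMod A) (α : N) (n : ℤ) (x : (F.obj α).X n) : F.res (𝟙 α) n x = x := by
  rw [res_apply, F.map_id]
  exact DGMod.extendId_unit _ _ _ _ _

lemma res_comp (F : DiagMod A) {α β γ : N} (s : α ⟶ β) (t : β ⟶ γ) (n : ℤ) (x : (F.obj α).X n) :
    F.res (s ≫ t) n x = F.res t n (F.res s n x) := by
  simp only [res_apply, F.map_comp]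
  simp only [HomologicalComplex.comp_f, ModuleCat.comp_apply, DGMod.extendComp_unit,
    DGMod.extend_map_unit]

lemma d_res (F : DiagMod A) {α β : N} (s : α ⟶ β) (i j : ℤ) (x : (F.obj α).X i) :
    (F.obj β).d i j (F.res s i x) = F.res s j ((F.obj α).d i j x) := by
  simp only [res_apply, ← DGMod.extend_d_unit]
  exact congr($((F.map s).comm i j) _)

lemma app_res {F G : DiagMod A} (φ : F ⟶ G) {α β : N} (s : α ⟶ β) (n : ℤ) (x : (F.obj α).X n) :
    (φ.app β).f n (F.res s n x) = G.res s n ((φ.app α).f n x) := by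
  simp only [res_apply, ← DGMod.extend_map_unit]
  exact congr(($(φ.naturality s)).f n (DGMod.unit _ _ n x)).symm

/-- Constructor for modules over a diagram of rings from semilinear restriction maps. -/
def ofRes (obj : ∀ α, DGMod (A.obj α))
    (res : ∀ {α β : N} (s : α ⟶ β) (n : ℤ), (obj α).X n →ₛₗ[(A.map s).hom] (obj β).X n)
    (d_res : ∀ {α β : N} (s : α ⟶ β) (n : ℤ) x,
      (obj β).d n (n + 1) (res s n x) = res s (n + 1) ((obj α).d n (n + 1) x))
    (res_id : ∀ (α : N) n x, res (𝟙 α) n x = x)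
    (res_comp : ∀ {α β γ : N} (s : α ⟶ β) (t : β ⟶ γ) n x,
      res (s ≫ t) n x = res t n (res s n x)) : DiagMod A where
  obj := obj
  map s := DGMod.extendDesc _ (res s) (d_res s)
  map_id α := by
    apply DGMod.extend_hom_ext
    intro n x
    rw [DGMod.extendDesc_unit, DGMod.extendId_unit, res_id]
  map_comp s t := by
    apply DGMod.extend_hom_ext
    intro n x
    simp only [HomologicalComplex.comp_f, ModuleCat.comp_apply, DGMod.extendComp_unit,
      DGMod.extend_map_unit, DGMod.extendDesc_unit, res_comp]

@[simp]
lemma ofRes_res (obj : ∀ α, DGMod (A.obj α)) (res d_res res_id res_comp) {α β : N} (s : α ⟶ β)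
    (n : ℤ) (x : (obj α).X n) :
    (ofRes obj res d_res res_id res_comp).res s n x = res s n x :=
  DGMod.extendDesc_unit _ (res s) (d_res s) _ _

/-- Constructor for morphisms in terms of restriction maps. -/
def homOfRes {F G : DiagMod A} (app : ∀ α, F.obj α ⟶ G.obj α)
    (h : ∀ {α β : N} (s : α ⟶ β) n x, (app β).f n (F.res s n x) = G.res s n ((app α).f n x)) :
    F ⟶ G where
  app := app
  naturality s := by
    apply DGMod.extend_hom_ext
    intro n x
    simp only [HomologicalComplex.comp_f, ModuleCat.comp_apply, DGMod.extend_map_unit]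
    exact (h s n x).symm

@[ext]
lemma hom_ext {F G : DiagMod A} {φ ψ : F ⟶ G} (h : ∀ α, φ.app α = ψ.app α) : φ = ψ :=
  Hom.ext (funext h)

@[simp]
lemma comp_app {F G H : DiagMod A} (φ : F ⟶ G) (ψ : G ⟶ H) (α : N) :
    (φ ≫ ψ).app α = φ.app α ≫ ψ.app α := rfl

/-- Evaluation at an index. -/
def eval (A : N ⥤ CommRingCat.{u}) (α : N) : DiagMod A ⥤ DGMod (A.obj α) where
  obj F := F.obj α
  map φ := φ.app α

end Elements

end DiagMod

namespace DGMod

/-- Colimits of complexes are formed degreewise, and in each degree extension of scalars is a left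
adjoint. -/
instance {R S : CommRingCat.{u}} (f : R ⟶ S) (J : Type u) [SmallCategory J] :
    PreservesColimitsOfShape J (extend f) := by
  apply HomologicalComplex.preservesColimitsOfShape_of_eval
  intro i
  change PreservesColimitsOfShape J (HomologicalComplex.eval _ _ i ⋙ ext₀ f.hom)
  infer_instance

end DGMod

namespace DiagMod

variable {N : Type u} [SmallCategory N] {A : N ⥤ CommRingCat.{u}}

/-! ### Limits, computed at each index -/

section Limits

variable {J : Type u} [SmallCategory J] (K : J ⥤ DiagMod A)

/-- The value at `α` of the limit of a diagram of modules. -/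
def limitAt (α : N) : DGMod (A.obj α) := limit (K ⋙ eval A α)

/-- The projections from `limitAt K α`. -/
def limitAtπ (α : N) (j : J) : limitAt K α ⟶ (K.obj j).obj α := limit.π (K ⋙ eval A α) j

variable {K} in
lemma limitAtπ_w (α : N) {i j : J} (f : i ⟶ j) :
    limitAtπ K α i ≫ (K.map f).app α = limitAtπ K α j :=
  limit.w (K ⋙ eval A α) f

variable {K} in
lemma limitAt_hom_ext {α : N} {M : DGMod (A.obj α)} {a b : M ⟶ limitAt K α}
    (h : ∀ j, a ≫ limitAtπ K α j = b ≫ limitAtπ K α j) : a = b :=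
  limit.hom_ext h

/-- Morphisms to `limitAt K α`. -/
def limitAtLift {α : N} {M : DGMod (A.obj α)} (f : ∀ j, M ⟶ (K.obj j).obj α)
    (hf : ∀ {i j : J} (s : i ⟶ j), f i ≫ (K.map s).app α = f j) : M ⟶ limitAt K α :=
  limit.lift (K ⋙ eval A α)
    { pt := M, π := { app := f, naturality := fun _ _ s => (Category.id_comp _).trans (hf s).symm } }

lemma limitAtLift_π {α : N} {M : DGMod (A.obj α)} (f : ∀ j, M ⟶ (K.obj j).obj α)
    (hf : ∀ {i j : J} (s : i ⟶ j), f i ≫ (K.map s).app α = f j) (j : J) :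
    limitAtLift K f hf ≫ limitAtπ K α j = f j :=
  limit.lift_π _ _

/-- The structure maps of a limit, computed at each index. -/
def limitMap {α β : N} (s : α ⟶ β) :
    (DGMod.extend (A.map s)).obj (limitAt K α) ⟶ limitAt K β :=
  limitAtLift K (fun j => (DGMod.extend (A.map s)).map (limitAtπ K α j) ≫ (K.obj j).map s)
    (fun {i j} f => by
      rw [Category.assoc, ← (K.map f).naturality s, ← Functor.map_comp_assoc, limitAtπ_w])

lemma limitMap_π {α β : N} (s : α ⟶ β) (j : J) :
    limitMap K s ≫ limitAtπ K β j =
      (DGMod.extend (A.map s)).map (limitAtπ K α j) ≫ (K.obj j).map s := by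
  exact limitAtLift_π K _ (fun {i j} f => by
    rw [Category.assoc, ← (K.map f).naturality s, ← Functor.map_comp_assoc, limitAtπ_w]) _

lemma limitMap_unit_π {α β : N} (s : α ⟶ β) (j : J) (n : ℤ) (x : (limitAt K α).X n) :
    (limitAtπ K β j).f n ((limitMap K s).f n (DGMod.unit _ _ n x)) =
      (K.obj j).res s n ((limitAtπ K α j).f n x) := by
  have h := congr(($(limitMap_π K s j)).f n (DGMod.unit _ _ n x))
  simp only [HomologicalComplex.comp_f, ModuleCat.comp_apply, DGMod.extend_map_unit] at h
  exact h

/-- The limit of a diagram of modules, computed at each index. -/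
def limitObj : DiagMod A where
  obj α := limitAt K α
  map s := limitMap K s
  map_id α := by
    apply limitAt_hom_ext
    intro j
    apply DGMod.extend_hom_ext
    intro n x
    simp only [HomologicalComplex.comp_f, ModuleCat.comp_apply, limitMap_unit_π,
      DGMod.extendId_unit, res_id]
  map_comp s t := by
    apply limitAt_hom_ext
    intro j
    apply DGMod.extend_hom_ext
    intro n x
    simp only [HomologicalComplex.comp_f, ModuleCat.comp_apply, limitMap_unit_π,
      DGMod.extendComp_unit, DGMod.extend_map_unit, res_comp]

/-- The limit cone of a diagram of modules, computed at each index. -/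
def limitCone : Cone K where
  pt := limitObj K
  π :=
    { app := fun j =>
        { app := fun α => limitAtπ K α j
          naturality := fun s => (limitMap_π K s j).symm }
      naturality := fun i j f => by
        ext1 α
        exact (Category.id_comp _).trans (limitAtπ_w α f).symm }

variable {K} in
/-- The components of a morphism to a limit. -/
def liftApp (c : Cone K) (α : N) : c.pt.obj α ⟶ limitAt K α :=
  limitAtLift K (fun j => (c.π.app j).app α) (fun s => by rw [← comp_app, c.w])

variable {K} in
lemma liftApp_π (c : Cone K) (α : N) (j : J) :
    liftApp c α ≫ limitAtπ K α j = (c.π.app j).app α :=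
  limitAtLift_π K _ (fun s => by rw [← comp_app, c.w]) j

variable {K} in
lemma liftApp_naturality (c : Cone K) {α β : N} (s : α ⟶ β) :
    (DGMod.extend (A.map s)).map (liftApp c α) ≫ limitMap K s = c.pt.map s ≫ liftApp c β := by
  apply limitAt_hom_ext
  intro j
  rw [Category.assoc, Category.assoc, limitMap_π, liftApp_π, ← Functor.map_comp_assoc,
    liftApp_π]
  exact (c.π.app j).naturality s

/-- The cone `limitCone K` is a limit cone. -/
def limitConeIsLimit : IsLimit (limitCone K) where
  lift c := { app := liftApp c, naturality := liftApp_naturality c }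
  fac c j := by
    ext1 α
    exact liftApp_π c α j
  uniq c m h := by
    ext1 α
    apply limitAt_hom_ext
    intro j
    rw [liftApp_π]
    exact congr(Hom.app $(h j) α)

instance : HasLimit K := ⟨⟨⟨_, limitConeIsLimit K⟩⟩⟩

end Limits

/-! ### Colimits, computed at each index -/

section Colimits

variable {J : Type u} [SmallCategory J] (K : J ⥤ DiagMod A)

/-- The value at `α` of the colimit of a diagram of modules. -/
def colimitAt (α : N) : DGMod (A.obj α) := colimit (K ⋙ eval A α)

/-- The inclusions in `colimitAt K α`. -/
def colimitAtι (α : N) (j : J) : (K.obj j).obj α ⟶ colimitAt K α := colimit.ι (K ⋙ eval A α) j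

variable {K} in
lemma colimitAtι_w (α : N) {i j : J} (f : i ⟶ j) :
    (K.map f).app α ≫ colimitAtι K α j = colimitAtι K α i :=
  colimit.w (K ⋙ eval A α) f

variable {K} in
lemma colimitAt_hom_ext {α : N} {M : DGMod (A.obj α)} {a b : colimitAt K α ⟶ M}
    (h : ∀ j, colimitAtι K α j ≫ a = colimitAtι K α j ≫ b) : a = b :=
  colimit.hom_ext h

/-- Morphisms from `colimitAt K α`. -/
def colimitAtDesc {α : N} {M : DGMod (A.obj α)} (f : ∀ j, (K.obj j).obj α ⟶ M)
    (hf : ∀ {i j : J} (s : i ⟶ j), (K.map s).app α ≫ f j = f i) : colimitAt K α ⟶ M :=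
  colimit.desc (K ⋙ eval A α)
    { pt := M, ι := { app := f, naturality := fun _ _ s => (hf s).trans (Category.comp_id _).symm } }

lemma ι_colimitAtDesc {α : N} {M : DGMod (A.obj α)} (f : ∀ j, (K.obj j).obj α ⟶ M)
    (hf : ∀ {i j : J} (s : i ⟶ j), (K.map s).app α ≫ f j = f i) (j : J) :
    colimitAtι K α j ≫ colimitAtDesc K f hf = f j :=
  colimit.ι_desc _ _

variable {K} in
lemma extend_colimitAt_hom_ext {α : N} {S : CommRingCat.{u}} {f : A.obj α ⟶ S} {M : DGMod S}
    {a b : (DGMod.extend f).obj (colimitAt K α) ⟶ M}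
    (h : ∀ j n x, a.f n (DGMod.unit f _ n ((colimitAtι K α j).f n x)) =
      b.f n (DGMod.unit f _ n ((colimitAtι K α j).f n x))) : a = b := by
  apply (isColimitOfPreserves (DGMod.extend f) (colimit.isColimit (K ⋙ eval A α))).hom_ext
  intro j
  apply DGMod.extend_hom_ext
  intro n x
  have e := DGMod.extend_map_unit f (colimitAtι K α j) n x
  exact (congrArg (a.f n) e).trans ((h j n x).trans (congrArg (b.f n) e).symm)

/-- The structure maps of a colimit, computed at each index. -/
def colimitMap {α β : N} (s : α ⟶ β) :
    (DGMod.extend (A.map s)).obj (colimitAt K α) ⟶ colimitAt K β :=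
  (isColimitOfPreserves (DGMod.extend (A.map s)) (colimit.isColimit (K ⋙ eval A α))).desc
    { pt := colimitAt K β
      ι :=
        { app := fun j => (K.obj j).map s ≫ colimitAtι K β j
          naturality := fun i j f => by
            have h : (DGMod.extend (A.map s)).map ((K.map f).app α) ≫ (K.obj j).map s ≫
                colimitAtι K β j = (K.obj i).map s ≫ colimitAtι K β i := by
              rw [← Category.assoc, (K.map f).naturality s, Category.assoc, colimitAtι_w]
            exact h.trans (Category.comp_id _).symm } }

lemma ι_colimitMap {α β : N} (s : α ⟶ β) (j : J) :
    (DGMod.extend (A.map s)).map (colimitAtι K α j) ≫ colimitMap K s =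
      (K.obj j).map s ≫ colimitAtι K β j :=
  (isColimitOfPreserves (DGMod.extend (A.map s)) (colimit.isColimit (K ⋙ eval A α))).fac _ _

lemma colimitMap_unit {α β : N} (s : α ⟶ β) (j : J) (n : ℤ) (x : ((K.obj j).obj α).X n) :
    (colimitMap K s).f n (DGMod.unit _ _ n ((colimitAtι K α j).f n x)) =
      (colimitAtι K β j).f n ((K.obj j).res s n x) := by
  have h := congr(($(ι_colimitMap K s j)).f n (DGMod.unit _ _ n x))
  simp only [HomologicalComplex.comp_f, ModuleCat.comp_apply, DGMod.extend_map_unit] at h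
  exact h

/-- The colimit of a diagram of modules, computed at each index. -/
def colimitObj : DiagMod A where
  obj α := colimitAt K α
  map s := colimitMap K s
  map_id α := by
    apply extend_colimitAt_hom_ext
    intro j n x
    rw [colimitMap_unit, DGMod.extendId_unit, res_id]
  map_comp s t := by
    apply extend_colimitAt_hom_ext
    intro j n x
    simp only [HomologicalComplex.comp_f, ModuleCat.comp_apply, colimitMap_unit,
      DGMod.extendComp_unit, DGMod.extend_map_unit]
    rw [res_comp]

/-- The colimit cocone of a diagram of modules, computed at each index. -/
def colimitCocone : Cocone K where
  pt := colimitObj K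
  ι :=
    { app := fun j =>
        { app := fun α => colimitAtι K α j
          naturality := fun s => ι_colimitMap K s j }
      naturality := fun i j f => by
        ext1 α
        exact (colimitAtι_w α f).trans (Category.comp_id _).symm }

variable {K} in
/-- The components of a morphism from a colimit. -/
def descApp (c : Cocone K) (α : N) : colimitAt K α ⟶ c.pt.obj α :=
  colimitAtDesc K (fun j => (c.ι.app j).app α) (fun s => by rw [← comp_app, c.w])

variable {K} in
lemma ι_descApp (c : Cocone K) (α : N) (j : J) :
    colimitAtι K α j ≫ descApp c α = (c.ι.app j).app α :=
  ι_colimitAtDesc K _ (fun s => by rw [← comp_app, c.w]) j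

variable {K} in
lemma descApp_naturality (c : Cocone K) {α β : N} (s : α ⟶ β) :
    (DGMod.extend (A.map s)).map (descApp c α) ≫ c.pt.map s = colimitMap K s ≫ descApp c β := by
  apply (isColimitOfPreserves (DGMod.extend (A.map s)) (colimit.isColimit (K ⋙ eval A α))).hom_ext
  intro j
  change (DGMod.extend (A.map s)).map (colimitAtι K α j) ≫ _ =
    (DGMod.extend (A.map s)).map (colimitAtι K α j) ≫ _
  rw [← Functor.map_comp_assoc, ι_descApp, ← Category.assoc, ι_colimitMap, Category.assoc,
    ι_descApp]
  exact (c.ι.app j).naturality s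

/-- The cocone `colimitCocone K` is a colimit cocone. -/
def colimitCoconeIsColimit : IsColimit (colimitCocone K) where
  desc c := { app := descApp c, naturality := descApp_naturality c }
  fac c j := by
    ext1 α
    exact ι_descApp c α j
  uniq c m h := by
    ext1 α
    apply colimitAt_hom_ext
    intro j
    rw [ι_descApp]
    exact congr(Hom.app $(h j) α)

instance : HasColimit K := ⟨⟨⟨_, colimitCoconeIsColimit K⟩⟩⟩

instance (α : N) : PreservesColimit K (eval A α) :=
  preservesColimit_of_preserves_colimit_cocone (colimitCoconeIsColimit K)
    (colimit.isColimit (K ⋙ eval A α))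

end Colimits

instance : HasLimits (DiagMod A) := ⟨fun _ _ => ⟨fun _ => inferInstance⟩⟩

instance : HasColimits (DiagMod A) := ⟨fun _ _ => ⟨fun _ => inferInstance⟩⟩

instance (α : N) : PreservesColimits (eval A α) := ⟨⟨inferInstance⟩⟩

end DiagMod

/-! ### Quasi-isomorphisms by elements, and contractible disks -/

namespace DGMod

variable {R : CommRingCat.{u}} {K L : DGMod R}

lemma d_d_apply (K : DGMod R) (i j k : ℤ) (x : K.X i) : K.d j k (K.d i j x) = 0 :=
  congr($(K.d_comp_d i j k) x)

lemma d_f_apply (f : K ⟶ L) (i j : ℤ) (x : K.X i) : L.d i j (f.f i x) = f.f j (K.d i j x) :=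
  congr($(f.comm i j) x)

lemma exists_iCycles_eq (K : DGMod R) {n : ℤ} {x : K.X n} (hx : K.d n (n + 1) x = 0) :
    ∃ c : K.cycles n, K.iCycles n c = x :=
  (ShortComplex.moduleCat_exact_iff _).1 (ShortComplex.exact_of_f_is_kernel
    (ShortComplex.mk _ _ (K.iCycles_d n (n + 1))) (K.cyclesIsKernel n (n + 1) (by simp))) x hx

lemma d_iCycles_apply (K : DGMod R) (n : ℤ) (c : K.cycles n) : K.d n (n + 1) (K.iCycles n c) = 0 :=
  congr($(K.iCycles_d n (n + 1)) c)

lemma iCycles_injective (K : DGMod R) (n : ℤ) : Function.Injective (K.iCycles n) :=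
  (ModuleCat.mono_iff_injective _).1 inferInstance

lemma homologyπ_surjective (K : DGMod R) (n : ℤ) : Function.Surjective (K.homologyπ n) :=
  (ModuleCat.epi_iff_surjective _).1 inferInstance

/-- Homology is the cokernel of `toCycles`. The degree is written `n + 1` so that the incoming
differential starts literally in degree `n`. -/
lemma homologyπ_eq_zero_iff (K : DGMod R) {n : ℤ} (c : K.cycles (n + 1)) :
    K.homologyπ (n + 1) c = 0 ↔ ∃ z : K.X n, K.d n (n + 1) z = K.iCycles (n + 1) c := by
  have h : ∀ z : K.X n, K.iCycles (n + 1) (K.toCycles n (n + 1) z) = K.d n (n + 1) z :=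
    fun z => congr($(K.toCycles_i n (n + 1)) z)
  constructor
  · intro hc
    obtain ⟨z, hz⟩ := (ShortComplex.moduleCat_exact_iff _).1 (ShortComplex.exact_of_g_is_cokernel
      (ShortComplex.mk _ _ (K.toCycles_comp_homologyπ n (n + 1)))
      (K.homologyIsCokernel n (n + 1) (by simp))) c hc
    exact ⟨z, by rw [← h]; exact congrArg _ hz⟩
  · rintro ⟨z, hz⟩
    rw [← h] at hz
    rw [← K.iCycles_injective _ hz]
    exact congr($(K.toCycles_comp_homologyπ n (n + 1)) z)

lemma iCycles_cyclesMap_apply (f : K ⟶ L) (n : ℤ) (c : K.cycles n) :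
    L.iCycles n (HomologicalComplex.cyclesMap f n c) = f.f n (K.iCycles n c) :=
  congr($(HomologicalComplex.cyclesMap_i f n) c)

lemma homologyMap_homologyπ_apply (f : K ⟶ L) (n : ℤ) (c : K.cycles n) :
    HomologicalComplex.homologyMap f n (K.homologyπ n c) =
      L.homologyπ n (HomologicalComplex.cyclesMap f n c) :=
  congr($(HomologicalComplex.homologyπ_naturality f n) c)

/-- Quasi-isomorphisms in terms of elements. -/
lemma quasiIso_iff (f : K ⟶ L) : QuasiIso f ↔
    (∀ (n : ℤ) (x : K.X (n + 1)) (y : L.X n), K.d (n + 1) (n + 1 + 1) x = 0 →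
      L.d n (n + 1) y = f.f (n + 1) x → ∃ z : K.X n, K.d n (n + 1) z = x) ∧
    (∀ (n : ℤ) (y : L.X (n + 1)), L.d (n + 1) (n + 1 + 1) y = 0 →
      ∃ x : K.X (n + 1), K.d (n + 1) (n + 1 + 1) x = 0 ∧
        ∃ z : L.X n, y = f.f (n + 1) x + L.d n (n + 1) z) := by
  have key : QuasiIso f ↔ ∀ n : ℤ,
      Function.Bijective (HomologicalComplex.homologyMap f (n + 1)) := by
    rw [_root_.quasiIso_iff]
    refine ⟨fun h n => ?_, fun h n => ?_⟩
    · have := (quasiIsoAt_iff_isIso_homologyMap f (n + 1)).1 (h (n + 1))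
      exact (ConcreteCategory.isIso_iff_bijective _).1 this
    · obtain ⟨n, rfl⟩ : ∃ m, n = m + 1 := ⟨n - 1, by ring⟩
      exact (quasiIsoAt_iff_isIso_homologyMap f (n + 1)).2
        ((ConcreteCategory.isIso_iff_bijective _).2 (h n))
  rw [key, ← forall_and]
  refine forall_congr' fun n => and_congr ?_ ?_
  · rw [injective_iff_map_eq_zero]
    constructor
    · intro h x y hx hy
      obtain ⟨c, rfl⟩ := K.exists_iCycles_eq hx
      rw [← homologyπ_eq_zero_iff]
      apply h
      rw [homologyMap_homologyπ_apply, homologyπ_eq_zero_iff]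
      exact ⟨y, by rw [iCycles_cyclesMap_apply, hy]⟩
    · intro h a ha
      obtain ⟨c, rfl⟩ := K.homologyπ_surjective _ a
      rw [homologyMap_homologyπ_apply, homologyπ_eq_zero_iff] at ha
      obtain ⟨y, hy⟩ := ha
      rw [homologyπ_eq_zero_iff]
      exact h _ y (K.d_iCycles_apply _ c) (by rw [hy, iCycles_cyclesMap_apply])
  · constructor
    · intro h y hy
      obtain ⟨c, rfl⟩ := L.exists_iCycles_eq hy
      obtain ⟨a, ha⟩ := h (L.homologyπ _ c)
      obtain ⟨b, rfl⟩ := K.homologyπ_surjective _ a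
      refine ⟨K.iCycles _ b, K.d_iCycles_apply _ b, ?_⟩
      rw [homologyMap_homologyπ_apply, ← sub_eq_zero, ← map_sub, homologyπ_eq_zero_iff] at ha
      obtain ⟨z, hz⟩ := ha
      refine ⟨-z, ?_⟩
      rw [map_neg, hz, map_sub, iCycles_cyclesMap_apply]
      abel
    · intro h a
      obtain ⟨c, rfl⟩ := L.homologyπ_surjective _ a
      obtain ⟨x, hx, z, hz⟩ := h _ (L.d_iCycles_apply _ c)
      obtain ⟨b, rfl⟩ := K.exists_iCycles_eq hx
      refine ⟨K.homologyπ _ b, ?_⟩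
      rw [homologyMap_homologyπ_apply, ← sub_eq_zero, ← map_sub, homologyπ_eq_zero_iff]
      refine ⟨-z, ?_⟩
      rw [map_neg, map_sub, iCycles_cyclesMap_apply, hz]
      abel

/-- The degreewise surjective quasi-isomorphisms, in terms of elements. -/
lemma trivialFib_iff (f : K ⟶ L) : (fib R f ∧ QuasiIso f) ↔
    ∀ (n : ℤ) (x : K.X (n + 1)) (y : L.X n), K.d (n + 1) (n + 1 + 1) x = 0 →
      L.d n (n + 1) y = f.f (n + 1) x → ∃ z : K.X n, K.d n (n + 1) z = x ∧ f.f n z = y := by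
  constructor
  · rintro ⟨hs, hf⟩ n x y hx hy
    obtain ⟨h₁, h₂⟩ := (quasiIso_iff f).1 hf
    -- `z₀` bounds `x` but may have the wrong image. The error `y - f z₀` is a cycle, hence the
    -- image of a cycle `x'` up to a boundary `d w`; lifting `w` along the surjection corrects `z₀`
    -- without changing its differential.
    obtain ⟨z₀, hz₀⟩ := h₁ n x y hx hy
    obtain ⟨n, rfl⟩ : ∃ m, n = m + 1 := ⟨n - 1, by ring⟩
    obtain ⟨x', hx', w, hw⟩ := h₂ n (y - f.f _ z₀) (by
      rw [map_sub, d_f_apply, hz₀, hy, sub_self])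
    obtain ⟨w', rfl⟩ := hs n w
    refine ⟨z₀ + x' + K.d n (n + 1) w', ?_, ?_⟩
    · rw [map_add, map_add, d_d_apply, hx', hz₀, add_zero, add_zero]
    · rw [map_add, map_add, ← d_f_apply, add_assoc, ← hw]
      abel
  · intro h
    -- The case `x = 0`: cycles lift to cycles.
    have h₂ (n : ℤ) (y : L.X n) (hy : L.d n (n + 1) y = 0) :
        ∃ z : K.X n, K.d n (n + 1) z = 0 ∧ f.f n z = y :=
      h n 0 y (map_zero _) (by rw [hy, map_zero])
    refine ⟨fun n y => ?_, (quasiIso_iff f).2 ⟨fun n x y hx hy => ?_, fun n y hy => ?_⟩⟩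
    -- For surjectivity the criterion is used twice: lift the cycle `d y` to a cycle `x`, then lift
    -- `y` to an element with differential `x`.
    · obtain ⟨x, hx, hx'⟩ := h₂ (n + 1) (L.d n (n + 1) y) (L.d_d_apply _ _ _ _)
      obtain ⟨z, -, hz⟩ := h n x y hx hx'.symm
      exact ⟨z, hz⟩
    · obtain ⟨z, hz, -⟩ := h n x y hx hy
      exact ⟨z, hz⟩
    · obtain ⟨z, hz, rfl⟩ := h₂ _ y hy
      exact ⟨z, hz, 0, by rw [map_zero, add_zero]⟩

/-- The differential `(x, y) ↦ (0, x)` of the disk. -/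
def diskD (B : DGMod R) (i j : ℤ) (h : i + 1 = j) :
    B.X i × B.X (i - 1) →ₗ[R] B.X j × B.X (j - 1) :=
  LinearMap.inr R _ _ ∘ₗ (B.XIsoOfEq (show i = j - 1 by lia)).hom.hom ∘ₗ LinearMap.fst R _ _

/-- The contractible complex `B^n ⊕ B^{n-1}` with differential `(x, y) ↦ (0, x)`. -/
def disk (B : DGMod R) : DGMod R where
  X n := ModuleCat.of R (B.X n × B.X (n - 1))
  d i j := if h : i + 1 = j then ModuleCat.ofHom (diskD B i j h) else 0
  shape i j h := dif_neg h
  d_comp_d' i j k h₁ h₂ := by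
    rw [dif_pos (show i + 1 = j from h₁), dif_pos (show j + 1 = k from h₂)]
    ext x <;> simp [diskD]

lemma disk_d (B : DGMod R) (i : ℤ) :
    (disk B).d i (i + 1) = ModuleCat.ofHom (diskD B i (i + 1) rfl) :=
  dif_pos rfl

/-- The degreewise surjective morphism from the disk on `B` to `B`. -/
def diskπ (B : DGMod R) : disk B ⟶ B where
  f n := ModuleCat.ofHom (X := B.X n × B.X (n - 1))
    (LinearMap.fst R _ _ + (B.d (n - 1) n).hom ∘ₗ LinearMap.snd R _ _)
  comm' i j hij := by
    obtain rfl : i + 1 = j := hij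
    rw [disk_d]
    ext z
    obtain ⟨x, y⟩ : B.X i × B.X (i - 1) := z
    have h : B.d (i + 1 - 1) (i + 1) ((B.XIsoOfEq (show i = i + 1 - 1 by ring)).hom x) =
        B.d i (i + 1) x := congr($(B.XIsoOfEq_hom_comp_d _ _) x)
    change B.d i (i + 1) (x + B.d (i - 1) i y) =
      0 + B.d (i + 1 - 1) (i + 1) ((B.XIsoOfEq (show i = i + 1 - 1 by ring)).hom x)
    rw [h, map_add, d_d_apply, add_zero, zero_add]

lemma diskπ_apply (B : DGMod R) (n : ℤ) (x : B.X n) (y : B.X (n - 1)) :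
    (diskπ B).f n (x, y) = x + B.d (n - 1) n y := rfl

lemma diskπ_fib (B : DGMod R) : fib R (diskπ B) := fun n x =>
  ⟨((x, 0) : B.X n × B.X (n - 1)), by rw [diskπ_apply, map_zero, add_zero]⟩

/-- A cycle `(x, y)` of the disk has `x = 0`, since the differential only moves `x` to the second
factor; its image is then `d y`. -/
lemma exists_diskπ_eq_d (B : DGMod R) (n : ℤ) (ξ : (disk B).X (n + 1))
    (hξ : (disk B).d (n + 1) (n + 1 + 1) ξ = 0) :
    ∃ z : B.X n, (diskπ B).f (n + 1) ξ = B.d n (n + 1) z := by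
  obtain ⟨x, y⟩ : B.X (n + 1) × B.X (n + 1 - 1) := ξ
  rw [disk_d] at hξ
  have hx : (B.XIsoOfEq (show n + 1 = n + 1 + 1 - 1 by ring)).hom x = 0 := congr(Prod.snd $hξ)
  obtain rfl : x = 0 := by
    rw [← map_zero (B.XIsoOfEq (show n + 1 = n + 1 + 1 - 1 by ring)).hom.hom] at hx
    exact ((ConcreteCategory.isIso_iff_bijective _).1 inferInstance).1 hx
  refine ⟨(B.XIsoOfEq (show n + 1 - 1 = n by ring)).hom y, ?_⟩
  rw [diskπ_apply, zero_add]
  exact congr($(B.XIsoOfEq_hom_comp_d _ _) y).symm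

/-- The morphisms with the left lifting property with respect to degreewise surjective morphisms
are quasi-isomorphisms. -/
lemma quasiIso_of_llp_fib {A B : DGMod R} {i : A ⟶ B} (hi : (fib R).llp i) : QuasiIso i := by
  -- The disk makes `i` factor through a surjection. Lifting the identity of `B` gives `(r, k)` with
  -- `r ∘ i = 1` and `i ∘ r + π ∘ k = 1`, and `π ∘ k` sends cycles to boundaries, so `r` inverts `i`
  -- on cohomology.
  let q : A ⊞ disk B ⟶ B := biprod.desc i (diskπ B)
  have hq : fib R q := fun n y => by
    obtain ⟨x, rfl⟩ := diskπ_fib B n y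
    refine ⟨(biprod.inr : disk B ⟶ A ⊞ disk B).f n x, ?_⟩
    exact congr(($(biprod.inr_desc i (diskπ B))).f n x)
  have := hi q hq
  have sq : CommSq (biprod.inl : A ⟶ A ⊞ disk B) i q (𝟙 B) := ⟨by simp [q]⟩
  have e₁ : i ≫ sq.lift ≫ biprod.fst = 𝟙 A := by
    rw [← Category.assoc, sq.fac_left, biprod.inl_fst]
  have e₂ : (sq.lift ≫ biprod.fst) ≫ i + (sq.lift ≫ biprod.snd) ≫ diskπ B = 𝟙 B := by
    refine Eq.trans ?_ ((congrArg (sq.lift ≫ ·) biprod.desc_eq.symm).trans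
      sq.fac_right)
    rw [Preadditive.comp_add, Category.assoc, Category.assoc]
  generalize sq.lift ≫ biprod.fst = r at e₁ e₂
  generalize sq.lift ≫ biprod.snd = k at e₂
  have e₁' (n : ℤ) (x : A.X n) : r.f n (i.f n x) = x := congr(($e₁).f n x)
  have e₂' (n : ℤ) (x : B.X n) : i.f n (r.f n x) + (diskπ B).f n (k.f n x) = x :=
    congr(($e₂).f n x)
  rw [quasiIso_iff]
  refine ⟨fun n x y hx hy => ⟨r.f n y, by rw [d_f_apply, hy, e₁']⟩, fun n y hy => ?_⟩
  obtain ⟨z, hz⟩ := exists_diskπ_eq_d B n (k.f _ y) (by rw [d_f_apply, hy, map_zero])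
  exact ⟨r.f _ y, by rw [d_f_apply, hy, map_zero], z, by rw [← hz, e₂']⟩

end DGMod

/-! ### Semilinear maps out of free modules -/

section Finsupp

variable {ι R S M : Type*} [Semiring R] [Semiring S] [AddCommMonoid M] [Module S M] (σ : R →+* S)

/-- The semilinear map out of a free module with prescribed values on a basis. -/
def finsuppLift (v : ι → M) : (ι →₀ R) →ₛₗ[σ] M where
  toFun x := x.sum fun i a => σ a • v i
  map_add' x y := Finsupp.sum_add_index' (by simp) (by simp [add_smul])
  map_smul' a x := by
    rw [Finsupp.sum_smul_index' (by simp), Finsupp.smul_sum]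
    simp [mul_smul]

lemma finsuppLift_single (v : ι → M) (i : ι) :
    finsuppLift σ v (Finsupp.single i 1) = v i := by
  change (Finsupp.single i (1 : R)).sum (fun i a => σ a • v i) = _
  rw [Finsupp.sum_single_index, map_one, one_smul]
  rw [map_zero, zero_smul]

variable {σ} in
lemma finsupp_induction {f g : (ι →₀ R) →ₛₗ[σ] M}
    (h : ∀ i, f (Finsupp.single i 1) = g (Finsupp.single i 1)) (x : ι →₀ R) : f x = g x := by
  induction x using Finsupp.induction_linear with
  | zero => simp
  | add x y hx hy => rw [map_add, map_add, hx, hy]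
  | single i a =>
    rw [← mul_one a, ← smul_eq_mul, ← Finsupp.smul_single, LinearMap.map_smulₛₗ,
      LinearMap.map_smulₛₗ, h]

end Finsupp

/-! ### Free disks, corepresenting elements -/

namespace DiagMod

variable {N : Type u} [SmallCategory N] {A : N ⥤ CommRingCat.{u}}

/-- The degrees `n` and `n + 1` of a basis of a disk. -/
inductive DiskIndex (n : ℤ) : ℤ → Type
  | bot : DiskIndex n n
  | top : DiskIndex n (n + 1)

section FreeDisk

variable (A) (α : N) (n : ℤ)

/-- The image of a basis element of a free disk by the differential. -/
def freeDiskδ (β : N) (k : ℤ) :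
    (α ⟶ β) × DiskIndex n k → ((α ⟶ β) × DiskIndex n (k + 1) →₀ A.obj β)
  | (s, .bot) => Finsupp.single (s, .top) 1
  | (_, .top) => 0

/-- The differential of a free disk. -/
def freeDiskD (β : N) (k : ℤ) :
    ((α ⟶ β) × DiskIndex n k →₀ A.obj β) →ₗ[A.obj β]
      ((α ⟶ β) × DiskIndex n (k + 1) →₀ A.obj β) :=
  Finsupp.linearCombination _ (freeDiskδ A α n β k)

lemma freeDiskD_single {β : N} {k : ℤ} (i : (α ⟶ β) × DiskIndex n k) :
    freeDiskD A α n β k (Finsupp.single i 1) = freeDiskδ A α n β k i := by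
  simp [freeDiskD]

/-- The values of a free disk. -/
def freeDiskObj (β : N) : DGMod (A.obj β) :=
  CochainComplex.of (fun k => ModuleCat.of (A.obj β) ((α ⟶ β) × DiskIndex n k →₀ A.obj β))
    (fun k => ModuleCat.ofHom (freeDiskD A α n β k)) (fun k => by
      ext ⟨s, b⟩ : 2
      cases b <;> ext : 1 <;> simp [freeDiskD, freeDiskδ])

/-- The basis elements of a free disk. -/
def freeDiskBasis {β : N} (s : α ⟶ β) {k : ℤ} (b : DiskIndex n k) : (freeDiskObj A α n β).X k :=
  (Finsupp.single (s, b) 1 : (α ⟶ β) × DiskIndex n k →₀ A.obj β)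

lemma freeDiskObj_d (β : N) (k : ℤ) :
    (freeDiskObj A α n β).d k (k + 1) = ModuleCat.ofHom (freeDiskD A α n β k) :=
  dif_pos rfl

lemma freeDiskObj_d_bot {β : N} (s : α ⟶ β) :
    (freeDiskObj A α n β).d n (n + 1) (freeDiskBasis A α n s .bot) = freeDiskBasis A α n s .top := by
  rw [freeDiskObj_d]
  exact freeDiskD_single A α n (s, .bot)

lemma freeDiskObj_d_top {β : N} (s : α ⟶ β) :
    (freeDiskObj A α n β).d (n + 1) (n + 1 + 1) (freeDiskBasis A α n s .top) = 0 := by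
  rw [← freeDiskObj_d_bot, DGMod.d_d_apply]

variable {A α n} in
lemma freeDisk_induction {β : N} {k : ℤ} {S : CommRingCat.{u}} {σ : A.obj β ⟶ S}
    {M : ModuleCat.{u} S} {f g : (freeDiskObj A α n β).X k →ₛₗ[σ.hom] M}
    (h : ∀ s b, f (freeDiskBasis A α n s b) = g (freeDiskBasis A α n s b))
    (x : (freeDiskObj A α n β).X k) : f x = g x :=
  finsupp_induction (f := f) (g := g) (fun i => h i.1 i.2) x

/-- Semilinear maps out of a free disk. -/
def freeDiskLift {β : N} {k : ℤ} {S : CommRingCat.{u}} (σ : A.obj β ⟶ S)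
    {M : ModuleCat.{u} S} (v : (α ⟶ β) → DiskIndex n k → M) :
    (freeDiskObj A α n β).X k →ₛₗ[σ.hom] M :=
  finsuppLift σ.hom (fun i : (α ⟶ β) × DiskIndex n k => v i.1 i.2)

lemma freeDiskLift_basis {β : N} {k : ℤ} {S : CommRingCat.{u}} (σ : A.obj β ⟶ S)
    {M : ModuleCat.{u} S} (v : (α ⟶ β) → DiskIndex n k → M) (s : α ⟶ β) (b : DiskIndex n k) :
    freeDiskLift A α n σ v (freeDiskBasis A α n s b) = v s b :=
  finsuppLift_single _ _ _

/-- The restriction maps of a free disk. -/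
def freeDiskRes {β γ : N} (s : β ⟶ γ) (k : ℤ) :
    (freeDiskObj A α n β).X k →ₛₗ[(A.map s).hom] (freeDiskObj A α n γ).X k :=
  freeDiskLift A α n (A.map s) (fun t b => freeDiskBasis A α n (t ≫ s) b)

lemma freeDiskRes_basis {β γ : N} (s : β ⟶ γ) {k : ℤ} (t : α ⟶ β) (b : DiskIndex n k) :
    freeDiskRes A α n s k (freeDiskBasis A α n t b) = freeDiskBasis A α n (t ≫ s) b :=
  freeDiskLift_basis _ _ _ _ _ _ _

/-- Composition of a semilinear map with a linear map. -/
abbrev compLinear {R S : CommRingCat.{u}} {σ : R ⟶ S} {M : ModuleCat.{u} R} {K L : ModuleCat.{u} S}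
    (g : K ⟶ L) (f : M →ₛₗ[σ.hom] K) : M →ₛₗ[σ.hom] L :=
  g.hom.comp f

/-- Composition of a linear map with a semilinear map. -/
abbrev linearComp {R S : CommRingCat.{u}} {σ : R ⟶ S} {M K : ModuleCat.{u} R} {L : ModuleCat.{u} S}
    (g : K →ₛₗ[σ.hom] L) (f : M ⟶ K) : M →ₛₗ[σ.hom] L :=
  g.comp f.hom

lemma freeDisk_d_res {β γ : N} (s : β ⟶ γ) (k : ℤ) (x : (freeDiskObj A α n β).X k) :
    (freeDiskObj A α n γ).d k (k + 1) (freeDiskRes A α n s k x) =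
      freeDiskRes A α n s (k + 1) ((freeDiskObj A α n β).d k (k + 1) x) := by
  refine freeDisk_induction
    (f := compLinear ((freeDiskObj A α n γ).d k (k + 1)) (freeDiskRes A α n s k))
    (g := linearComp (freeDiskRes A α n s (k + 1)) ((freeDiskObj A α n β).d k (k + 1)))
    (fun t b => ?_) x
  change (freeDiskObj A α n γ).d k (k + 1) (freeDiskRes A α n s k _) =
    freeDiskRes A α n s (k + 1) ((freeDiskObj A α n β).d k (k + 1) _)
  cases b
  · rw [freeDiskRes_basis, freeDiskObj_d_bot, freeDiskObj_d_bot, freeDiskRes_basis]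
  · rw [freeDiskRes_basis, freeDiskObj_d_top, freeDiskObj_d_top, map_zero]

/-- The module which corepresents `F ↦ (F_α)^n`. -/
def freeDisk : DiagMod A :=
  ofRes (freeDiskObj A α n) (freeDiskRes A α n) (freeDisk_d_res A α n)
    (fun β k x => by
      have e : (A.map (𝟙 β)).hom = RingHom.id _ := by simp
      -- The restriction map is semilinear over `A.map (𝟙 β)`, which is only propositionally the
      -- identity. Generalising the ring map allows substitution, after which both sides are linear
      -- and are compared on the basis. The composition law below is treated in the same way.
      have key (σ : A.obj β →+* A.obj β) (e : σ = RingHom.id _)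
          (f : (freeDiskObj A α n β).X k →ₛₗ[σ] (freeDiskObj A α n β).X k)
          (h : ∀ t b, f (freeDiskBasis A α n t b) = freeDiskBasis A α n t b) : f x = x := by
        subst e
        exact finsupp_induction (f := f) (g := LinearMap.id) (fun i => h i.1 i.2) x
      exact key _ e _ (fun t b => by rw [freeDiskRes_basis, Category.comp_id]))
    (fun {β γ δ} s t k x => by
      have e : (A.map (s ≫ t)).hom = (A.map t).hom.comp (A.map s).hom := by simp
      have key (σ : A.obj β →+* A.obj δ) (e : σ = (A.map t).hom.comp (A.map s).hom)
          (f : (freeDiskObj A α n β).X k →ₛₗ[σ] (freeDiskObj A α n δ).X k)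
          (h : ∀ u b, f (freeDiskBasis A α n u b) = freeDiskBasis A α n (u ≫ s ≫ t) b) :
          f x = freeDiskRes A α n t k (freeDiskRes A α n s k x) := by
        subst e
        have : RingHomCompTriple (A.map s).hom (A.map t).hom ((A.map t).hom.comp (A.map s).hom) :=
          ⟨rfl⟩
        refine finsupp_induction (f := f)
          (g := (freeDiskRes A α n t k).comp (freeDiskRes A α n s k)) (fun i => ?_) x
        refine (h i.1 i.2).trans ?_
        change _ = freeDiskRes A α n t k (freeDiskRes A α n s k (freeDiskBasis A α n i.1 i.2))
        rw [freeDiskRes_basis, freeDiskRes_basis, Category.assoc]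
      exact key _ e _ (fun u b => freeDiskRes_basis _ _ _ _ _ _))

/-- The generator of a free disk. -/
def freeDiskGen : ((freeDisk A α n).obj α).X n := freeDiskBasis A α n (𝟙 α) .bot

variable {A α n}

lemma freeDisk_res_gen {β : N} (s : α ⟶ β) :
    (freeDisk A α n).res s n (freeDiskGen A α n) = freeDiskBasis A α n s .bot := by
  refine (ofRes_res _ _ _ _ _ _ _ _).trans ?_
  rw [freeDiskGen, freeDiskRes_basis, Category.id_comp]

/-- The generator determines everything: the basis elements of degree `n` are its restrictions, and
those of degree `n + 1` are their differentials. -/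
lemma freeDisk_hom_ext {F : DiagMod A} {φ ψ : freeDisk A α n ⟶ F}
    (h : (φ.app α).f n (freeDiskGen A α n) = (ψ.app α).f n (freeDiskGen A α n)) : φ = ψ := by
  have h' {β : N} (s : α ⟶ β) : (φ.app β).f n (freeDiskBasis A α n s .bot) =
      (ψ.app β).f n (freeDiskBasis A α n s .bot) := by
    rw [← freeDisk_res_gen, app_res, app_res, h]
  ext1 β
  ext1 k
  ext x
  refine finsupp_induction (f := ((φ.app β).f k).hom) (g := ((ψ.app β).f k).hom) (fun i => ?_) x
  obtain ⟨s, b⟩ := i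
  change (φ.app β).f k (freeDiskBasis A α n s b) = (ψ.app β).f k (freeDiskBasis A α n s b)
  cases b
  · exact h' s
  · rw [← freeDiskObj_d_bot]
    exact (DGMod.d_f_apply (φ.app β) _ _ _).symm.trans
      ((congrArg _ (h' s)).trans (DGMod.d_f_apply (ψ.app β) _ _ _))

/-- The values on basis elements of a morphism out of a free disk. -/
def freeDiskVal {F : DiagMod A} (x : (F.obj α).X n) {β : N} (s : α ⟶ β) :
    ∀ {k : ℤ}, DiskIndex n k → (F.obj β).X k
  | _, .bot => F.res s n x
  | _, .top => F.res s (n + 1) ((F.obj α).d n (n + 1) x)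

/-- The components of a morphism out of a free disk. -/
def freeDiskDescApp {F : DiagMod A} (x : (F.obj α).X n) (β : N) :
    freeDiskObj A α n β ⟶ F.obj β where
  f k := ModuleCat.ofHom (X := (α ⟶ β) × DiskIndex n k →₀ A.obj β)
    (finsuppLift (RingHom.id _) (fun i => freeDiskVal x i.1 i.2))
  comm' i j hij := by
    obtain rfl : i + 1 = j := hij
    have h (k : ℤ) (s : α ⟶ β) (b : DiskIndex n k) :
        finsuppLift (RingHom.id (A.obj β))
          (fun i : (α ⟶ β) × DiskIndex n k => freeDiskVal x i.1 i.2)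
          (freeDiskBasis A α n s b) = freeDiskVal x s b := finsuppLift_single _ _ _
    ext y
    refine finsupp_induction (σ := RingHom.id (A.obj β))
      (f := ((F.obj β).d i (i + 1)).hom ∘ₗ finsuppLift (RingHom.id _)
        (fun i => freeDiskVal x i.1 i.2))
      (g := finsuppLift (RingHom.id (A.obj β))
        (fun i : (α ⟶ β) × DiskIndex n _ => freeDiskVal x i.1 i.2) ∘ₗ
          ((freeDiskObj A α n β).d i (i + 1)).hom) (fun i => ?_) y
    obtain ⟨s, b⟩ := i
    change (F.obj β).d i (i + 1) (finsuppLift (RingHom.id (A.obj β)) _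
      (freeDiskBasis A α n s b)) = finsuppLift (RingHom.id (A.obj β)) _
        ((freeDiskObj A α n β).d i (i + 1) (freeDiskBasis A α n s b))
    rw [h]
    cases b
    · rw [freeDiskObj_d_bot, h]
      exact d_res F s _ _ x
    · rw [freeDiskObj_d_top]
      exact ((d_res F s _ _ _).trans (by rw [DGMod.d_d_apply, map_zero])).trans
        (map_zero (finsuppLift (RingHom.id (A.obj β))
          (fun i : (α ⟶ β) × DiskIndex n _ => freeDiskVal x i.1 i.2))).symm

lemma freeDiskDescApp_basis {F : DiagMod A} (x : (F.obj α).X n) {β : N} (s : α ⟶ β) {k : ℤ}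
    (b : DiskIndex n k) :
    (freeDiskDescApp x β).f k (freeDiskBasis A α n s b) = freeDiskVal x s b :=
  finsuppLift_single _ _ _

/-- The morphism out of a free disk given by an element. -/
def freeDiskDesc {F : DiagMod A} (x : (F.obj α).X n) : freeDisk A α n ⟶ F :=
  homOfRes (freeDiskDescApp x) (fun {β γ} s k y => by
    refine finsupp_induction
      (f := compLinear ((freeDiskDescApp x γ).f k) ((freeDisk A α n).res s k))
      (g := linearComp (F.res s k) ((freeDiskDescApp x β).f k)) (fun i => ?_) y
    obtain ⟨t, b⟩ := i
    change (freeDiskDescApp x γ).f k ((freeDisk A α n).res s k (freeDiskBasis A α n t b)) =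
      F.res s k ((freeDiskDescApp x β).f k (freeDiskBasis A α n t b))
    have e : (freeDisk A α n).res s k (freeDiskBasis A α n t b) = freeDiskBasis A α n (t ≫ s) b :=
      (ofRes_res _ _ _ _ _ _ _ _).trans (freeDiskRes_basis _ _ _ _ _ _)
    rw [e, freeDiskDescApp_basis, freeDiskDescApp_basis]
    cases b
    · exact res_comp F t s _ _
    · exact res_comp F t s _ _)

lemma freeDiskDesc_gen {F : DiagMod A} (x : (F.obj α).X n) :
    ((freeDiskDesc x).app α).f n (freeDiskGen A α n) = x :=
  (freeDiskDescApp_basis x (𝟙 α) .bot).trans (res_id _ _ _ _)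

end FreeDisk
end DiagMod

namespace DiagMod

variable {N : Type u} [SmallCategory N] {A : N ⥤ CommRingCat.{u}}

lemma freeDiskDesc_comp {α : N} {n : ℤ} {F G : DiagMod A} (x : (F.obj α).X n) (φ : F ⟶ G) :
    freeDiskDesc x ≫ φ = freeDiskDesc ((φ.app α).f n x) := by
  apply freeDisk_hom_ext
  rw [freeDiskDesc_gen]
  exact congrArg _ (freeDiskDesc_gen x)

lemma freeDiskDesc_eq {α : N} {n : ℤ} {F : DiagMod A} (φ : freeDisk A α n ⟶ F) :
    φ = freeDiskDesc ((φ.app α).f n (freeDiskGen A α n)) :=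
  freeDisk_hom_ext (by rw [freeDiskDesc_gen])

/-! ### Spheres, corepresenting cycles -/

section Sphere

variable (A) (α : N) (n : ℤ)

/-- The module which corepresents the cycles of degree `n` at `α`. -/
def sphere : DiagMod A :=
  coequalizer
    (freeDiskDesc (((freeDisk A α n).obj α).d n (n + 1) (freeDiskGen A α n)))
    (freeDiskDesc (0 : ((freeDisk A α n).obj α).X (n + 1)))

/-- The projection from a free disk to a sphere. -/
def sphereπ : freeDisk A α n ⟶ sphere A α n := coequalizer.π _ _

/-- The universal cycle. -/
def sphereGen : ((sphere A α n).obj α).X n := ((sphereπ A α n).app α).f n (freeDiskGen A α n)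

variable {A α n}

/-- The coequalizer identifies the map classifying the differential of the generator with the one
classifying zero. -/
lemma d_sphereGen : ((sphere A α n).obj α).d n (n + 1) (sphereGen A α n) = 0 := by
  have h := coequalizer.condition
    (freeDiskDesc (((freeDisk A α n).obj α).d n (n + 1) (freeDiskGen A α n)))
    (freeDiskDesc (0 : ((freeDisk A α n).obj α).X (n + 1)))
  rw [freeDiskDesc_comp, freeDiskDesc_comp] at h
  have h' := congr(((Hom.app $h α).f (n + 1)) (freeDiskGen A α (n + 1)))
  rw [freeDiskDesc_gen, freeDiskDesc_gen, map_zero, ← DGMod.d_f_apply] at h'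
  exact h'

lemma sphere_hom_ext {F : DiagMod A} {φ ψ : sphere A α n ⟶ F}
    (h : (φ.app α).f n (sphereGen A α n) = (ψ.app α).f n (sphereGen A α n)) : φ = ψ := by
  apply coequalizer.hom_ext
  apply freeDisk_hom_ext
  exact h

/-- The morphism out of a sphere given by a cycle. -/
def sphereDesc {F : DiagMod A} (x : (F.obj α).X n) (hx : (F.obj α).d n (n + 1) x = 0) :
    sphere A α n ⟶ F :=
  coequalizer.desc (freeDiskDesc x) (by
    rw [freeDiskDesc_comp, freeDiskDesc_comp, map_zero, ← DGMod.d_f_apply, freeDiskDesc_gen, hx])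

lemma sphereDesc_gen {F : DiagMod A} (x : (F.obj α).X n) (hx : (F.obj α).d n (n + 1) x = 0) :
    ((sphereDesc x hx).app α).f n (sphereGen A α n) = x := by
  have h : sphereπ A α n ≫ sphereDesc x hx = freeDiskDesc x := coequalizer.π_desc _ _
  refine Eq.trans ?_ (freeDiskDesc_gen x)
  rw [← h]
  rfl

variable (A α n) in
/-- The inclusion of a sphere as the boundary of a free disk. -/
def sphereInclusion : sphere A α (n + 1) ⟶ freeDisk A α n :=
  sphereDesc (((freeDisk A α n).obj α).d n (n + 1) (freeDiskGen A α n))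
    (DGMod.d_d_apply _ _ _ _ _)

end Sphere

/-! ### Generating cofibrations and trivial cofibrations -/

section Generators

variable (A)

/-- The generating cofibrations. -/
def genCof : MorphismProperty (DiagMod A) :=
  .ofHoms (fun i : N × ℤ => sphereInclusion A i.1 i.2)

/-- The generating trivial cofibrations. -/
def genTrivCof : MorphismProperty (DiagMod A) :=
  .ofHoms (fun i : N × ℤ => initial.to (freeDisk A i.1 i.2))

/-- The morphisms which are surjective in each degree at each index. -/
def fib : MorphismProperty (DiagMod A) := fun _ _ φ => ∀ α, DGMod.fib _ (φ.app α)

/-- The morphisms which are quasi-isomorphisms at each index. -/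
def weq : MorphismProperty (DiagMod A) := fun _ _ φ => ∀ α, QuasiIso (φ.app α)

variable {A}

/-- A square from `0 ⟶ freeDisk A α n` to `p` is an element `y` of degree `n` of the target at `α`,
and a lift is a preimage of `y`. -/
lemma genTrivCof_rlp : (genTrivCof A).rlp = fib A := by
  ext F G p
  constructor
  · intro hp α n y
    have := hp _ (MorphismProperty.ofHoms.mk (f := fun i : N × ℤ =>
      initial.to (freeDisk A i.1 i.2)) (α, n))
    have sq : CommSq (initial.to F) (initial.to (freeDisk A α n)) p (freeDiskDesc y) :=
      ⟨initial.hom_ext _ _⟩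
    obtain ⟨l, hl⟩ : ∃ l, l ≫ p = freeDiskDesc y := ⟨sq.lift, sq.fac_right⟩
    refine ⟨(l.app α).f n (freeDiskGen A α n), Eq.trans ?_ (freeDiskDesc_gen y)⟩
    rw [← hl]
    rfl
  · rintro hp _ _ _ ⟨α, n⟩
    refine ⟨fun {f g} sq => ⟨?_⟩⟩
    obtain ⟨x, hx⟩ := hp α n ((g.app α).f n (freeDiskGen A α n))
    exact ⟨
      { l := freeDiskDesc x
        fac_left := initial.hom_ext _ _
        fac_right := by rw [freeDiskDesc_comp, hx, ← freeDiskDesc_eq] }⟩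

/-- A square from `sphereInclusion A α n` to `p` is a cycle `x` of degree `n + 1` together with `y`
such that `d y = p x`; a lift is a `z` with `d z = x` and `p z = y`. This is precisely the criterion
`DGMod.trivialFib_iff`. -/
lemma genCof_rlp : (genCof A).rlp = fib A ⊓ weq A := by
  have h (F G : DiagMod A) (p : F ⟶ G) : (fib A ⊓ weq A) p ↔
      ∀ α, DGMod.fib _ (p.app α) ∧ QuasiIso (p.app α) := forall_and.symm
  ext F G p
  rw [h]
  simp_rw [DGMod.trivialFib_iff]
  constructor
  · intro hp α n x y hx hy
    have := hp _ (MorphismProperty.ofHoms.mk (f := fun i : N × ℤ => sphereInclusion A i.1 i.2)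
      (α, n))
    have sq : CommSq (sphereDesc x hx) (sphereInclusion A α n) p (freeDiskDesc y) := ⟨by
      apply sphere_hom_ext
      rw [comp_app, comp_app, HomologicalComplex.comp_f, HomologicalComplex.comp_f,
        ModuleCat.comp_apply, ModuleCat.comp_apply, sphereDesc_gen, sphereInclusion,
        sphereDesc_gen, ← DGMod.d_f_apply, freeDiskDesc_gen, hy]⟩
    obtain ⟨l, hl₁, hl₂⟩ : ∃ l, sphereInclusion A α n ≫ l = sphereDesc x hx ∧
      l ≫ p = freeDiskDesc y := ⟨sq.lift, sq.fac_left, sq.fac_right⟩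
    refine ⟨(l.app α).f n (freeDiskGen A α n), ?_, Eq.trans ?_ (freeDiskDesc_gen y)⟩
    · rw [DGMod.d_f_apply]
      refine Eq.trans ?_ (sphereDesc_gen x hx)
      rw [← hl₁, comp_app, HomologicalComplex.comp_f, ModuleCat.comp_apply,
        sphereInclusion, sphereDesc_gen]
    · rw [← hl₂]
      rfl
  · rintro hp _ _ _ ⟨α, n⟩
    refine ⟨fun {f g} sq => ⟨?_⟩⟩
    obtain ⟨z, hz₁, hz₂⟩ := hp α n ((f.app α).f (n + 1) (sphereGen A α (n + 1)))
      ((g.app α).f n (freeDiskGen A α n))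
      (by rw [DGMod.d_f_apply, d_sphereGen, map_zero])
      (by
        rw [DGMod.d_f_apply]
        have := congr((Hom.app $(sq.w) α).f (n + 1) (sphereGen A α (n + 1)))
        rw [comp_app, comp_app, HomologicalComplex.comp_f, HomologicalComplex.comp_f,
          ModuleCat.comp_apply, ModuleCat.comp_apply, sphereInclusion, sphereDesc_gen] at this
        exact this.symm)
    exact ⟨
      { l := freeDiskDesc z
        fac_left := by
          apply sphere_hom_ext
          rw [comp_app, HomologicalComplex.comp_f, ModuleCat.comp_apply, sphereInclusion,
            sphereDesc_gen, ← DGMod.d_f_apply, freeDiskDesc_gen, hz₁]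
        fac_right := by rw [freeDiskDesc_comp, hz₂, ← freeDiskDesc_eq] }⟩

end Generators

/-! ### Finite presentability and the small object argument -/

section SmallObject

variable (A) (α : N) (n : ℤ)

/-- Free disks corepresent elements. -/
def freeDiskCoyoneda : coyoneda.obj (.op (freeDisk A α n)) ≅
    eval A α ⋙ HomologicalComplex.eval _ _ n ⋙ forget (ModuleCat.{u} (A.obj α)) :=
  NatIso.ofComponents (fun F => Equiv.toIso
    { toFun := fun φ => ((φ.app α).f n (freeDiskGen A α n) : (F.obj α).X n)
      invFun := fun x => freeDiskDesc x
      left_inv := fun φ => (freeDiskDesc_eq φ).symm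
      right_inv := fun x => freeDiskDesc_gen x })
    (fun _ => rfl)

/-- The corepresented functor takes the degree-`n` elements at `α`; evaluation at `α`, evaluation in
degree `n` and the forgetful functor all preserve filtered colimits. -/
instance : IsFinitelyPresentable.{u} (freeDisk A α n) := by
  rw [isFinitelyPresentable_iff_preservesFilteredColimits]
  constructor
  intro J _ _
  exact preservesColimitsOfShape_of_natIso (freeDiskCoyoneda A α n).symm

attribute [local instance] Cardinal.fact_isRegular_aleph0 Cardinal.orderBotAleph0OrdToType

/-- A coequalizer of free disks is a finite colimit of finitely presentable objects. -/
instance : IsFinitelyPresentable.{u} (sphere A α n) := by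
  have (k : WalkingParallelPair) : IsFinitelyPresentable.{u} ((parallelPair
      (freeDiskDesc (((freeDisk A α n).obj α).d n (n + 1) (freeDiskGen A α n)))
      (freeDiskDesc (0 : ((freeDisk A α n).obj α).X (n + 1)))).obj k) := by
    cases k <;> dsimp <;> infer_instance
  exact isCardinalPresentable_of_isColimit _ (colimit.isColimit (parallelPair
      (freeDiskDesc (((freeDisk A α n).obj α).d n (n + 1) (freeDiskGen A α n)))
      (freeDiskDesc (0 : ((freeDisk A α n).obj α).X (n + 1))))) Cardinal.aleph0.{u} (by
        rw [hasCardinalLT_aleph0_iff]; infer_instance)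

instance : IsFinitelyPresentable.{u} (⊥_ (DiagMod A)) := by
  have (k : Discrete PEmpty.{1}) : IsFinitelyPresentable.{u} ((Functor.empty.{0} (DiagMod A)).obj k) :=
    k.as.elim
  exact isCardinalPresentable_of_isColimit _ (colimit.isColimit (Functor.empty.{0} (DiagMod A)))
      Cardinal.aleph0.{u} (by
        rw [hasCardinalLT_aleph0_iff]; infer_instance)

variable {A}

instance : MorphismProperty.HasSmallObjectArgument.{u} (genCof A) := by
  have : (genCof A).IsCardinalForSmallObjectArgument Cardinal.aleph0.{u} :=
    { isSmall := MorphismProperty.isSmall_ofHoms _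
      preservesColimit := by
        rintro _ _ _ _ _ ⟨i⟩ f hf
        infer_instance }
  exact ⟨.aleph0, inferInstance, inferInstance, inferInstance⟩

instance : MorphismProperty.HasSmallObjectArgument.{u} (genTrivCof A) := by
  have : (genTrivCof A).IsCardinalForSmallObjectArgument Cardinal.aleph0.{u} :=
    { isSmall := MorphismProperty.isSmall_ofHoms _
      preservesColimit := by
        rintro _ _ _ _ _ ⟨i⟩ f hf
        infer_instance }
  exact ⟨.aleph0, inferInstance, inferInstance, inferInstance⟩

end SmallObject

end DiagMod

namespace DiagMod

/-! ### Latching modules by elements -/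

section Latching

variable {N : Type u} [PartialOrder N] {A : N ⥤ CommRingCat.{u}} {α : N}

/-- The elements of the latching module which come from an index `γ < α`. -/
def latchingι (F : DiagMod A) {γ : N} (h : γ < α) (n : ℤ) :
    (F.obj γ).X n →ₛₗ[(A.map (homOfLE h.le)).hom] (F.latching α).X n :=
  ((colimit.ι (F.latchingDiagram α) ⟨γ, h⟩).f n).hom.comp (DGMod.unit _ (F.obj γ) n)

lemma latchingι_apply (F : DiagMod A) {γ : N} (h : γ < α) (n : ℤ) (x : (F.obj γ).X n) :
    F.latchingι h n x =
      (colimit.ι (F.latchingDiagram α) ⟨γ, h⟩).f n (DGMod.unit _ (F.obj γ) n x) := rfl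

lemma latchingMap_latchingι (F : DiagMod A) {γ : N} (h : γ < α) (n : ℤ) (x : (F.obj γ).X n) :
    (F.latchingMap α).f n (F.latchingι h n x) = F.res (homOfLE h.le) n x := by
  have := colimit.ι_desc (F := F.latchingDiagram α)
    { pt := F.obj α
      ι :=
        { app := fun γ => F.map (homOfLE γ.2.le)
          naturality := fun γ δ s =>
            (F.latchingTransition_map (leOfHom s : γ.1 ≤ δ.1) δ.2.le).trans
              (Category.comp_id _).symm } } ⟨γ, h⟩
  exact congr(($this).f n (DGMod.unit _ (F.obj γ) n x))

lemma mapLatching_latchingι {F G : DiagMod A} (φ : F ⟶ G) {γ : N} (h : γ < α) (n : ℤ)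
    (x : (F.obj γ).X n) :
    (mapLatching φ α).f n (F.latchingι h n x) = G.latchingι h n ((φ.app γ).f n x) := by
  have := ι_colimMap (F := G.latchingDiagram α) (G := F.latchingDiagram α)
    { app := fun γ => (DGMod.extend (A.map (homOfLE γ.2.le))).map (φ.app γ)
      naturality := fun γ δ s =>
        latchingTransition_naturality φ (leOfHom s : γ.1 ≤ δ.1) δ.2.le } ⟨γ, h⟩
  have h' := congr(($this).f n (DGMod.unit _ (F.obj γ) n x))
  refine h'.trans ?_
  rw [latchingι_apply, ← DGMod.extend_map_unit]
  rfl

lemma latching_hom_ext {F : DiagMod A} {M : DGMod (A.obj α)} {a b : F.latching α ⟶ M}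
    (h : ∀ {γ : N} (h : γ < α) n x, a.f n (F.latchingι h n x) = b.f n (F.latchingι h n x)) :
    a = b := by
  apply colimit.hom_ext
  intro γ
  apply DGMod.extend_hom_ext
  intro n x
  exact h γ.2 n x

lemma latchingι_res (F : DiagMod A) {γ δ : N} (h : γ ≤ δ) (h' : δ < α) (n : ℤ)
    (x : (F.obj γ).X n) :
    F.latchingι h' n (F.res (homOfLE h) n x) = F.latchingι (h.trans_lt h') n x := by
  have := colimit.w (F.latchingDiagram α)
    (homOfLE h : (⟨γ, h.trans_lt h'⟩ : {γ : N // γ < α}) ⟶ ⟨δ, h'⟩)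
  have e := congr(($this).f n (DGMod.unit _ (F.obj γ) n x))
  refine Eq.trans ?_ e
  have e' : (F.latchingTransition h h'.le).f n (DGMod.unit _ (F.obj γ) n x) =
      DGMod.unit _ (F.obj δ) n (F.res (homOfLE h) n x) := by
    rw [latchingTransition, HomologicalComplex.comp_f, ModuleCat.comp_apply,
      DGMod.extendComp_unit, DGMod.extend_map_unit]
    rfl
  exact congrArg ((colimit.ι (F.latchingDiagram α) ⟨δ, h'⟩).f n) e'.symm

lemma d_latchingι (F : DiagMod A) {γ : N} (h : γ < α) (i j : ℤ) (x : (F.obj γ).X i) :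
    (F.latching α).d i j (F.latchingι h i x) = F.latchingι h j ((F.obj γ).d i j x) := by
  rw [latchingι_apply, latchingι_apply, ← DGMod.extend_d_unit]
  exact DGMod.d_f_apply (colimit.ι (F.latchingDiagram α) ⟨γ, h⟩) i j _

section Desc

variable {F : DiagMod A} {M : DGMod (A.obj α)}
  (v : ∀ {γ : N} (h : γ < α) (n : ℤ), (F.obj γ).X n →ₛₗ[(A.map (homOfLE h.le)).hom] M.X n)
  (hd : ∀ {γ : N} (h : γ < α) (n : ℤ) x,
    M.d n (n + 1) (v h n x) = v h (n + 1) ((F.obj γ).d n (n + 1) x))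
  (hv : ∀ {γ δ : N} (h : γ ≤ δ) (h' : δ < α) n x,
    v h' n (F.res (homOfLE h) n x) = v (h.trans_lt h') n x)

/-- The cocone on the latching diagram given by semilinear maps. -/
def latchingCocone : Cocone (F.latchingDiagram α) where
  pt := M
  ι :=
    { app := fun γ => DGMod.extendDesc _ (v γ.2) (hd γ.2)
      naturality := fun γ δ s => by
        refine Eq.trans ?_ (Category.comp_id _).symm
        apply DGMod.extend_hom_ext
        intro n x
        change (DGMod.extendDesc _ (v δ.2) (hd δ.2)).f n
          ((F.latchingTransition (leOfHom s) δ.2.le).f n _) = _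
        rw [latchingTransition, HomologicalComplex.comp_f, ModuleCat.comp_apply,
          DGMod.extendComp_unit, DGMod.extend_map_unit, DGMod.extendDesc_unit]
        exact (hv _ _ _ _).trans (DGMod.extendDesc_unit _ (v γ.2) (hd γ.2) n x).symm }

/-- Morphisms out of the latching module. -/
def latchingDesc : F.latching α ⟶ M :=
  colimit.desc (F.latchingDiagram α) (latchingCocone v hd hv)

lemma latchingDesc_latchingι {γ : N} (h : γ < α) (n : ℤ) (x : (F.obj γ).X n) :
    (latchingDesc v hd hv).f n (F.latchingι h n x) = v h n x := by
  have := colimit.ι_desc (latchingCocone v hd hv) ⟨γ, h⟩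
  exact congr(($this).f n (DGMod.unit _ (F.obj γ) n x)).trans
    (DGMod.extendDesc_unit _ (v h) (hd h) n x)

end Desc

lemma inl_relLatchingMap {F G : DiagMod A} (φ : F ⟶ G) :
    pushout.inl (mapLatching φ α) (F.latchingMap α) ≫ relLatchingMap φ α = G.latchingMap α :=
  pushout.inl_desc _ _ _

lemma inr_relLatchingMap {F G : DiagMod A} (φ : F ⟶ G) :
    pushout.inr (mapLatching φ α) (F.latchingMap α) ≫ relLatchingMap φ α = φ.app α :=
  pushout.inr_desc _ _ _

end Latching

/-! ### Lifting by recursion on the index -/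

section Reedy

/-- Construction of compatible families by well-founded recursion. -/
lemma exists_compatible_family {N : Type*} [PartialOrder N] [WellFoundedLT N] {T : N → Type*}
    [∀ α, Nonempty (T α)] (Q : ∀ α, T α → Prop) (R : ∀ {γ α : N}, γ < α → T γ → T α → Prop)
    (step : ∀ (α : N) (t : ∀ γ, T γ),
      (∀ γ < α, Q γ (t γ) ∧ ∀ (δ : N) (h : δ < γ), R h (t δ) (t γ)) →
        ∃ x : T α, Q α x ∧ ∀ (γ : N) (h : γ < α), R h (t γ) x) :
    ∃ t : ∀ α, T α, ∀ α, Q α (t α) ∧ ∀ (γ : N) (h : γ < α), R h (t γ) (t α) := by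
  classical
  let P (α : N) (t : ∀ γ, γ < α → T γ) (x : T α) : Prop :=
    Q α x ∧ ∀ (γ : N) (h : γ < α), R h (t γ h) x
  -- The recursion takes a solution whenever one exists and an arbitrary value otherwise; the final
  -- induction shows that the second case never occurs.
  let t : ∀ α, T α := wellFounded_lt.fix fun α t => if h : ∃ x, P α t x then h.choose else
    Classical.arbitrary _
  have ht (α : N) (h : ∃ x, P α (fun γ _ => t γ) x) : P α (fun γ _ => t γ) (t α) := by
    have e : t α = h.choose := by
      change wellFounded_lt.fix _ α = _
      rw [WellFounded.fix_eq]
      exact dif_pos h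
    rw [e]
    exact h.choose_spec
  refine ⟨t, fun α => ?_⟩
  induction α using WellFoundedLT.induction with
  | ind α ih => exact ht α (step α t ih)

variable {N : Type u} [PartialOrder N] {A : N ⥤ CommRingCat.{u}} {α : N}

/-- The Reedy argument: given lifts at all `γ < α`, a lift at `α` compatible with them is a lift of
the relative latching map at `α` against `p.app α`, which is a degreewise surjective
quasi-isomorphism. -/
lemma llp_of_relLatchingMap [WellFoundedLT N] {F G : DiagMod A} (φ : F ⟶ G)
    (hφ : ∀ α, DGMod.cof _ (relLatchingMap φ α)) : (fib A ⊓ weq A).llp φ := by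
  rintro X Y p ⟨hp, hp'⟩
  refine ⟨fun {f g} sq => ?_⟩
  obtain ⟨t, ht⟩ := exists_compatible_family (T := fun α => G.obj α ⟶ X.obj α)
    (fun α t => φ.app α ≫ t = f.app α ∧ t ≫ p.app α = g.app α)
    (fun {γ α} h t t' => ∀ n (x : (G.obj γ).X n),
      t'.f n (G.res (homOfLE h.le) n x) = X.res (homOfLE h.le) n (t.f n x)) (by
    intro α t ht
    -- The compatible lifts below `α`, followed by restriction to `α`, glue to a map out of the
    -- latching module.
    let u : G.latching α ⟶ X.obj α := latchingDesc
      (fun {γ} h n => (X.res (homOfLE h.le) n).comp ((t γ).f n).hom)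
      (fun h n x => (d_res X _ _ _ _).trans (congrArg _ (DGMod.d_f_apply _ _ _ _)))
      (fun {γ δ} h h' n x => by
        -- The recursion records compatibility for strict inequalities only; equality is the
        -- identity law for restrictions.
        obtain rfl | hlt := h.eq_or_lt
        · exact congrArg (fun y => X.res _ n ((t γ).f n y)) (res_id G γ n x)
        · exact (congrArg _ ((ht δ h').2 γ hlt n x)).trans (res_comp X _ _ _ _).symm)
    have hu {γ : N} (h : γ < α) (n : ℤ) (x : (G.obj γ).X n) :
        u.f n (G.latchingι h n x) = X.res (homOfLE h.le) n ((t γ).f n x) :=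
      latchingDesc_latchingι _ _ _ h n x
    have e₁ : mapLatching φ α ≫ u = F.latchingMap α ≫ f.app α := by
      apply latching_hom_ext
      intro γ h n x
      simp only [HomologicalComplex.comp_f, ModuleCat.comp_apply]
      rw [mapLatching_latchingι, hu, latchingMap_latchingι, app_res, ← (ht γ h).1.1]
      rfl
    have := hφ α (p.app α) ⟨hp α, hp' α⟩
    have sq' : CommSq (pushout.desc u (f.app α) e₁) (relLatchingMap φ α) (p.app α) (g.app α) := ⟨by
      apply pushout.hom_ext
      · rw [pushout.inl_desc_assoc, relLatchingMap, pushout.inl_desc_assoc]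
        apply latching_hom_ext
        intro γ h n x
        simp only [HomologicalComplex.comp_f, ModuleCat.comp_apply]
        rw [hu, latchingMap_latchingι, app_res, app_res, ← (ht γ h).1.2]
        rfl
      · rw [pushout.inr_desc_assoc, relLatchingMap, pushout.inr_desc_assoc]
        exact congr(Hom.app $(sq.w) α)⟩
    refine ⟨sq'.lift, ⟨?_, sq'.fac_right⟩, fun γ h n x => ?_⟩
    · have e := congr(pushout.inr _ _ ≫ $(sq'.fac_left))
      rwa [pushout.inr_desc, ← Category.assoc, inr_relLatchingMap] at e
    -- On the latching summand the lift equals `u`, which is exactly compatibility with the earlier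
    -- lifts.
    · have e := congr(pushout.inl _ _ ≫ $(sq'.fac_left))
      rw [pushout.inl_desc, ← Category.assoc, inl_relLatchingMap] at e
      rw [← hu h, ← latchingMap_latchingι G h]
      exact congr(($e).f n (G.latchingι h n x)))
  refine ⟨⟨
    { l := homOfRes t (fun {γ α} s n x => ?_)
      fac_left := hom_ext fun α => (ht α).1.1
      fac_right := hom_ext fun α => (ht α).1.2 }⟩⟩
  obtain rfl | hlt := (leOfHom s).eq_or_lt
  · obtain rfl : s = 𝟙 _ := Subsingleton.elim _ _
    rw [res_id, res_id]
  · exact (ht α).2 γ hlt n x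

end Reedy

end DiagMod

namespace DiagMod

/-! ### Matching modules, dual to the relative latching construction -/

section Matching

variable {N : Type u} [PartialOrder N] {A : N ⥤ CommRingCat.{u}} {α : N}

/-- Restriction of scalars from `A_α` to `A_γ`. -/
abbrev restr (A : N ⥤ CommRingCat.{u}) {γ α : N} (h : γ ≤ α) :
    ModuleCat.{u} (A.obj α) ⥤ ModuleCat.{u} (A.obj γ) :=
  ModuleCat.restrictScalars (A.map (homOfLE h)).hom

variable {M M' : DGMod (A.obj α)} (p : M ⟶ M')

/-- The values of the matching module: families in `M` indexed by `γ < α` and in `M'` indexed by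
`γ ≤ α` which are compatible with `p`. -/
def matchingX (γ : N) (n : ℤ) : Submodule (A.obj γ)
    ((∀ h : PLift (γ < α), (restr A h.down.le).obj (M.X n)) ×
      (∀ h : PLift (γ ≤ α), (restr A h.down).obj (M'.X n))) where
  carrier := {x | ∀ h : γ < α, p.f n (x.1 ⟨h⟩ : M.X n) = (x.2 ⟨h.le⟩ : M'.X n)}
  add_mem' {x y} hx hy h := by
    exact (map_add (p.f n).hom (x.1 ⟨h⟩ : M.X n) (y.1 ⟨h⟩ : M.X n)).trans
      (congrArg₂ (fun a b : M'.X n => a + b) (hx h) (hy h))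
  zero_mem' h := map_zero (p.f n).hom
  smul_mem' a x hx h := by
    exact (map_smul (p.f n).hom (A.map (homOfLE h.le) a) (x.1 ⟨h⟩ : M.X n)).trans
      (congrArg (fun y : M'.X n => A.map (homOfLE h.le) a • y) (hx h))

variable {p} in
/-- The components in `M` of an element of the matching module. -/
def matchingFst {γ : N} {n : ℤ} (x : matchingX p γ n) (h : γ < α) : M.X n := x.1.1 ⟨h⟩

variable {p} in
/-- The components in `M'` of an element of the matching module. -/
def matchingSnd {γ : N} {n : ℤ} (x : matchingX p γ n) (h : γ ≤ α) : M'.X n := x.1.2 ⟨h⟩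

variable {p} in
lemma matchingFst_snd {γ : N} {n : ℤ} (x : matchingX p γ n) (h : γ < α) :
    p.f n (matchingFst x h) = matchingSnd x h.le := x.2 h

/-- Constructor for elements of the matching module. -/
def matchingMk {γ : N} {n : ℤ} (a : γ < α → M.X n) (b : γ ≤ α → M'.X n)
    (h : ∀ h : γ < α, p.f n (a h) = b h.le) : matchingX p γ n :=
  ⟨(fun h => a h.down, fun h => b h.down), h⟩

variable {p} in
lemma matching_ext {γ : N} {n : ℤ} {x y : matchingX p γ n}
    (h₁ : ∀ h : γ < α, matchingFst x h = matchingFst y h)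
    (h₂ : ∀ h : γ ≤ α, matchingSnd x h = matchingSnd y h) : x = y :=
  Subtype.ext (Prod.ext (funext fun h => h₁ h.down) (funext fun h => h₂ h.down))

/-- The differential of the matching module. -/
def matchingD (γ : N) (i j : ℤ) : matchingX p γ i →ₗ[A.obj γ] matchingX p γ j where
  toFun x := matchingMk p (fun h => M.d i j (matchingFst x h))
    (fun h => M'.d i j (matchingSnd x h))
    (fun h => by rw [← DGMod.d_f_apply, matchingFst_snd])
  map_add' x y := matching_ext (fun h => map_add (M.d i j).hom _ _)
    (fun h => map_add (M'.d i j).hom _ _)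
  map_smul' a x := matching_ext
    (fun h => map_smul (M.d i j).hom (A.map (homOfLE h.le) a) (matchingFst x h))
    (fun h => map_smul (M'.d i j).hom (A.map (homOfLE h) a) (matchingSnd x h))

/-- The values of the matching module. -/
def matchingObj (γ : N) : DGMod (A.obj γ) where
  X n := ModuleCat.of (A.obj γ) (matchingX p γ n)
  d i j := ModuleCat.ofHom (matchingD p γ i j)
  shape i j hij := ModuleCat.hom_ext <| LinearMap.ext fun x =>
    matching_ext (p := p) (x := matchingD p γ i j x) (y := 0)
      (fun h => congr(ConcreteCategory.hom $(M.shape i j hij) (matchingFst (p := p) x h)))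
      (fun h => congr(ConcreteCategory.hom $(M'.shape i j hij) (matchingSnd (p := p) x h)))
  d_comp_d' i j k _ _ := ModuleCat.hom_ext <| LinearMap.ext fun x =>
    matching_ext (p := p) (x := matchingD p γ j k (matchingD p γ i j x)) (y := 0)
      (fun h => DGMod.d_d_apply M i j k (matchingFst (p := p) x h))
      (fun h => DGMod.d_d_apply M' i j k (matchingSnd (p := p) x h))

/-- The restriction maps of the matching module. -/
def matchingRes {γ δ : N} (s : γ ⟶ δ) (n : ℤ) :
    (matchingObj p γ).X n →ₛₗ[(A.map s).hom] (matchingObj p δ).X n where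
  toFun x := matchingMk p (fun h => matchingFst x ((leOfHom s).trans_lt h))
    (fun h => matchingSnd x ((leOfHom s).trans h)) (fun h => matchingFst_snd x _)
  map_add' x y := rfl
  map_smul' a x := by
    have e (h : δ ≤ α) : A.map (homOfLE ((leOfHom s).trans h)) a =
        A.map (homOfLE h) (A.map s a) := by
      rw [← CommRingCat.comp_apply, ← A.map_comp]
      rfl
    exact matching_ext
      (fun h => congr($(e h.le) • matchingFst x ((leOfHom s).trans_lt h)))
      (fun h => congr($(e h) • matchingSnd x ((leOfHom s).trans h)))

/-- The matching module: families in `M` indexed by `γ < α` and in `M'` indexed by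
`γ ≤ α` which are compatible with `p`. -/
def matching : DiagMod A :=
  ofRes (matchingObj p) (matchingRes p) (fun _ _ _ => rfl) (fun _ _ _ => rfl)
    (fun _ _ _ _ => rfl)

lemma matching_res {γ δ : N} (s : γ ⟶ δ) (n : ℤ) (x : (matchingObj p γ).X n) :
    (matching p).res s n x = matchingRes p s n x :=
  ofRes_res _ _ _ _ _ _ _ _

section Functoriality

variable {L L' : DGMod (A.obj α)} {q : L ⟶ L'} (a : M ⟶ L) (b : M' ⟶ L') (w : p ≫ b = a ≫ q)

variable {p} in
/-- Functoriality of the values of the matching module. -/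
def matchingXMap (γ : N) (n : ℤ) : matchingX p γ n →ₗ[A.obj γ] matchingX q γ n where
  toFun x := matchingMk q (fun h => a.f n (matchingFst x h)) (fun h => b.f n (matchingSnd x h))
    (fun h => by
      rw [← matchingFst_snd x h]
      exact congr(($w).f n (matchingFst x h)).symm)
  map_add' x y := matching_ext (fun h => map_add (a.f n).hom _ _)
    (fun h => map_add (b.f n).hom _ _)
  map_smul' c x := matching_ext
    (fun h => map_smul (a.f n).hom (A.map (homOfLE h.le) c) (matchingFst x h))
    (fun h => map_smul (b.f n).hom (A.map (homOfLE h) c) (matchingSnd x h))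

variable {p} in
/-- Functoriality of the values of the matching module. -/
def matchingObjMap (γ : N) : matchingObj p γ ⟶ matchingObj q γ where
  f n := ModuleCat.ofHom (matchingXMap a b w γ n)
  comm' i j _ := ModuleCat.hom_ext <| LinearMap.ext fun x =>
    matching_ext (p := q) (x := matchingD q γ i j (matchingXMap a b w γ i x))
      (y := matchingXMap a b w γ j (matchingD p γ i j x))
      (fun h => DGMod.d_f_apply a i j (matchingFst (p := p) x h))
      (fun h => DGMod.d_f_apply b i j (matchingSnd (p := p) x h))

variable {p} in
/-- Functoriality of the matching module. -/
def matchingMap : matching p ⟶ matching q :=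
  homOfRes (fun γ => matchingObjMap a b w γ) (fun {γ δ} s n x =>
    (congrArg (matchingXMap a b w δ n) (matching_res p s n x)).trans
      (matching_res q s n (matchingXMap a b w γ n x)).symm)

end Functoriality

section Lift

variable {F : DiagMod A} (v : F.latching α ⟶ M) (w : F.obj α ⟶ M')
  (hvw : v ≫ p = F.latchingMap α ≫ w)

variable {p} in
/-- The components of the morphism to a matching module which corresponds to a relative latching
datum. -/
def matchingXLift (γ : N) (n : ℤ) : (F.obj γ).X n →ₗ[A.obj γ] matchingX p γ n where
  toFun x := matchingMk p (fun h => v.f n (F.latchingι h n x))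
    (fun h => w.f n (F.res (homOfLE h) n x))
    (fun h => by
      rw [← latchingMap_latchingι F h]
      exact congr(($hvw).f n (F.latchingι h n x)))
  map_add' x y := matching_ext
    (fun h => (congrArg (v.f n) (map_add (F.latchingι h n) x y)).trans (map_add (v.f n).hom _ _))
    (fun h => (congrArg (w.f n) (map_add (F.res (homOfLE h) n) x y)).trans
      (map_add (w.f n).hom _ _))
  map_smul' c x := matching_ext
    (fun h => (congrArg (v.f n) ((F.latchingι h n).map_smulₛₗ c x)).trans
      (map_smul (v.f n).hom _ _))
    (fun h => (congrArg (w.f n) ((F.res (homOfLE h) n).map_smulₛₗ c x)).trans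
      (map_smul (w.f n).hom _ _))

variable {p} in
/-- The components of the morphism to a matching module which corresponds to a relative latching
datum. -/
def matchingObjLift (γ : N) : F.obj γ ⟶ matchingObj p γ where
  f n := ModuleCat.ofHom (matchingXLift v w hvw γ n)
  comm' i j _ := ModuleCat.hom_ext <| LinearMap.ext fun x =>
    matching_ext (p := p) (x := matchingD p γ i j (matchingXLift v w hvw γ i x))
      (y := matchingXLift v w hvw γ j ((F.obj γ).d i j x))
      (fun h => (DGMod.d_f_apply v i j (F.latchingι h i x)).trans
        (congrArg (v.f j) (d_latchingι F h i j x)))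
      (fun h => (DGMod.d_f_apply w i j (F.res (homOfLE h) i x)).trans
        (congrArg (w.f j) (d_res F (homOfLE h) i j x)))

variable {p} in
/-- The morphism to a matching module which corresponds to a relative latching datum. -/
def matchingLift : F ⟶ matching p :=
  homOfRes (fun γ => matchingObjLift v w hvw γ) (fun {γ δ} s n x =>
    (matching_ext (p := p) (x := matchingXLift v w hvw δ n (F.res s n x))
      (y := matchingRes p s n (matchingXLift v w hvw γ n x))
      (fun h => congrArg (v.f n) (latchingι_res F (leOfHom s) h n x))
      (fun h => congrArg (w.f n) (res_comp F s (homOfLE h) n x).symm)).trans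
    (matching_res p s n (matchingXLift v w hvw γ n x)).symm)

end Lift

/-- The component in `M` at `α` of a morphism to a matching module. -/
def ofMatching {F : DiagMod A} (φ : F ⟶ matching p) : F.obj α ⟶ M' where
  f n := ModuleCat.ofHom
    { toFun := fun x => matchingSnd (p := p) ((φ.app α).f n x) le_rfl
      map_add' := fun x y => congrArg (fun z => matchingSnd (p := p) z le_rfl)
        (map_add ((φ.app α).f n).hom x y)
      map_smul' := fun c x => by
        refine (congrArg (fun z => matchingSnd (p := p) z le_rfl)
          (map_smul ((φ.app α).f n).hom c x)).trans ?_
        -- The component at `α` carries scalars restricted along the identity arrow, so linearity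
        -- needs `A.map_id`.
        have e : A.map (homOfLE (le_refl α)) c = c := congr($(A.map_id α) c)
        exact congr($e • matchingSnd (p := p) ((φ.app α).f n x) le_rfl) }
  comm' i j _ := by
    ext x
    exact congrArg (fun z => matchingSnd (p := p) z le_rfl) (DGMod.d_f_apply (φ.app α) i j x)

end Matching
end DiagMod

namespace DiagMod

/-! ### Transposing lifting problems to matching modules -/

section

variable {N : Type u} [PartialOrder N] {A : N ⥤ CommRingCat.{u}} {α : N}

/-- Up to isomorphism this map is the identity of `M` at each `γ < α`, `p` itself at `α`, and zero
elsewhere. -/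
lemma matchingMap_trivialFib {M M' : DGMod (A.obj α)} (p : M ⟶ M')
    (hp : DGMod.fib _ p ∧ QuasiIso p) :
    (fib A ⊓ weq A) (matchingMap (p := 𝟙 M) (q := p) (𝟙 M) p rfl) := by
  rw [DGMod.trivialFib_iff] at hp
  have key (γ : N) : DGMod.fib _ ((matchingMap (p := 𝟙 M) (q := p) (𝟙 M) p rfl).app γ) ∧
      QuasiIso ((matchingMap (p := 𝟙 M) (q := p) (𝟙 M) p rfl).app γ) := by
    rw [DGMod.trivialFib_iff]
    intro n (x : matchingX (𝟙 M) γ (n + 1)) (y : matchingX p γ n) hx hy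
    have hx₁ (h : γ ≤ α) : M.d (n + 1) (n + 1 + 1) (matchingSnd x h) = 0 :=
      congrArg (fun z : matchingX (𝟙 M) γ (n + 1 + 1) => matchingSnd z h) hx
    have hy₁ (h : γ < α) : M.d n (n + 1) (matchingFst y h) = matchingFst x h :=
      congrArg (fun z : matchingX p γ (n + 1) => matchingFst z h) hy
    have hy₂ (h : γ ≤ α) : M'.d n (n + 1) (matchingSnd y h) = p.f (n + 1) (matchingSnd x h) :=
      congrArg (fun z : matchingX p γ (n + 1) => matchingSnd z h) hy
    have (h : γ ≤ α) : ∃ z : M.X n, M.d n (n + 1) z = matchingSnd x h ∧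
        p.f n z = matchingSnd y h ∧ ∀ h' : γ < α, z = matchingFst y h' := by
      by_cases h' : γ < α
      -- Below `α` the lift is forced to be the `M`-component of `y`; at `α` there is no such
      -- component and the criterion for `p` supplies it.
      · exact ⟨matchingFst y h', (hy₁ h').trans (matchingFst_snd x h'), matchingFst_snd y h',
          fun _ => rfl⟩
      · obtain ⟨z, h₁, h₂⟩ := hp n _ _ (hx₁ h) (hy₂ h)
        exact ⟨z, h₁, h₂, fun h'' => (h' h'').elim⟩
    choose z hz₁ hz₂ hz₃ using this
    refine ⟨matchingMk (𝟙 M) (fun h => z h.le) z (fun _ => rfl), ?_, ?_⟩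
    · exact matching_ext (p := 𝟙 M)
        (x := matchingD (𝟙 M) γ n (n + 1) (matchingMk (𝟙 M) (fun h => z h.le) z fun _ => rfl))
        (y := x) (fun h => (hz₁ h.le).trans (matchingFst_snd x h).symm) hz₁
    · exact matching_ext (p := p) (x := matchingXMap (p := 𝟙 M) (q := p) (𝟙 M) p rfl γ n
        (matchingMk (𝟙 M) (fun h => z h.le) z fun _ => rfl)) (y := y)
        (fun h => hz₃ h.le h) hz₂
  exact ⟨fun γ => (key γ).1, fun γ => (key γ).2⟩

/-- By adjunction: a square from `relLatchingMap φ α` to `p` transposes to a square from `φ` to the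
trivial fibration `matching (𝟙 M) ⟶ matching p`, and the component at `α` of a lift there is the
lift sought. -/
lemma relLatchingMap_of_llp {F G : DiagMod A} (φ : F ⟶ G) (hφ : (fib A ⊓ weq A).llp φ) (α : N) :
    DGMod.cof _ (relLatchingMap φ α) := by
  intro M M' p hp
  refine ⟨fun {u w} sq => ?_⟩
  let u₁ : G.latching α ⟶ M := pushout.inl _ _ ≫ u
  let u₂ : F.obj α ⟶ M := pushout.inr _ _ ≫ u
  have h₁₂ : mapLatching φ α ≫ u₁ = F.latchingMap α ≫ u₂ := pushout.condition_assoc u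
  have h₁ : u₁ ≫ p = G.latchingMap α ≫ w := by
    rw [Category.assoc, sq.w, ← Category.assoc, inl_relLatchingMap]
  have h₂ : u₂ ≫ p = φ.app α ≫ w := by
    rw [Category.assoc, sq.w, ← Category.assoc, inr_relLatchingMap]
  have sq' : CommSq (matchingLift (p := 𝟙 M) (F.latchingMap α ≫ u₂) u₂ (Category.comp_id _)) φ
      (matchingMap (p := 𝟙 M) (q := p) (𝟙 M) p rfl) (matchingLift u₁ w h₁) := ⟨by
    ext γ n x
    refine matching_ext (p := p)
      (x := matchingXMap (p := 𝟙 M) (q := p) (𝟙 M) p rfl γ n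
        (matchingXLift (p := 𝟙 M) (F.latchingMap α ≫ u₂) u₂ (Category.comp_id _) γ n x))
      (y := matchingXLift u₁ w h₁ γ n ((φ.app γ).f n x)) (fun h => ?_) (fun h => ?_)
    · change (F.latchingMap α ≫ u₂).f n (F.latchingι h n x) =
        u₁.f n (G.latchingι h n ((φ.app γ).f n x))
      rw [← h₁₂, ← mapLatching_latchingι]
      rfl
    · change (u₂ ≫ p).f n (F.res (homOfLE h) n x) = w.f n (G.res (homOfLE h) n ((φ.app γ).f n x))
      rw [h₂, ← app_res]
      rfl⟩
  have := hφ _ (matchingMap_trivialFib p hp)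
  obtain ⟨l, hl₁, hl₂⟩ : ∃ l, φ ≫ l = _ ∧ l ≫ _ = _ := ⟨sq'.lift, sq'.fac_left, sq'.fac_right⟩
  have hl₁' (n : ℤ) (x : (F.obj α).X n) : matchingSnd (p := 𝟙 M)
      ((l.app α).f n ((φ.app α).f n x)) le_rfl = u₂.f n x := by
    refine congr(matchingSnd (p := 𝟙 M) ((Hom.app $hl₁ α).f n x) le_rfl).trans ?_
    exact congrArg (u₂.f n) (res_id F α n x)
  have hl₂' (n : ℤ) (y : (G.obj α).X n) : p.f n (matchingSnd (p := 𝟙 M)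
      ((l.app α).f n y) le_rfl) = w.f n y := by
    refine congr(matchingSnd (p := p) ((Hom.app $hl₂ α).f n y) le_rfl).trans ?_
    exact congrArg (w.f n) (res_id G α n y)
  -- Below `α` the target `matching p` still remembers the component in `M`, so the lower triangle
  -- prescribes the lift on the image of `L_α G` in `M` and not merely after applying `p`.
  have hl₃ {γ : N} (h : γ < α) (n : ℤ) (y : (G.obj γ).X n) : matchingSnd (p := 𝟙 M)
      ((l.app α).f n (G.res (homOfLE h.le) n y)) le_rfl = u₁.f n (G.latchingι h n y) := by
    refine (congrArg (fun z : matchingX (𝟙 M) α n => matchingSnd z le_rfl)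
      ((app_res l (homOfLE h.le) n y).trans (matching_res (𝟙 M) _ n ((l.app γ).f n y)))).trans ?_
    refine (matchingFst_snd (p := 𝟙 M) ((l.app γ).f n y) h).symm.trans ?_
    exact congr(matchingFst (p := p) ((Hom.app $hl₂ γ).f n y) h)
  refine ⟨⟨{ l := ofMatching (𝟙 M) l, fac_left := ?_, fac_right := ?_ }⟩⟩
  · apply pushout.hom_ext
    · rw [← Category.assoc, inl_relLatchingMap]
      apply latching_hom_ext
      intro γ h n y
      refine Eq.trans ?_ (hl₃ h n y)
      exact congrArg ((ofMatching (𝟙 M) l).f n) (latchingMap_latchingι G h n y)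
    · rw [← Category.assoc, inr_relLatchingMap]
      ext n x
      exact hl₁' n x
  · ext n y
    exact hl₂' n y

/-- Evaluation at `α` has the right adjoint `M ↦ matching (𝟙 M)`, which takes surjections to
fibrations. Hence `i.app α` lifts against all surjections and `DGMod.quasiIso_of_llp_fib` applies;
no analysis of cell complexes is needed. -/
lemma llp_fib_le_weq : (fib A).llp ≤ weq A := by
  intro F G i hi α
  apply DGMod.quasiIso_of_llp_fib
  intro M M' p hp
  refine ⟨fun {u w} sq => ?_⟩
  have hq : fib A (matchingMap (p := 𝟙 M) (q := 𝟙 M') p p rfl) := by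
    intro γ n (y : matchingX (𝟙 M') γ n)
    -- Preimages are chosen by a single function, so that the two components of the constructed
    -- family agree where both exist.
    choose z hz using hp n
    exact ⟨matchingMk (𝟙 M) (fun h => z (matchingSnd y h.le)) (fun h => z (matchingSnd y h))
      (fun _ => rfl), matching_ext (p := 𝟙 M')
        (x := matchingXMap (p := 𝟙 M) (q := 𝟙 M') p p rfl γ n
          (matchingMk (𝟙 M) (fun h => z (matchingSnd y h.le)) (fun h => z (matchingSnd y h))
            (fun _ => rfl))) (y := y)
        (fun h => (hz _).trans (matchingFst_snd y h).symm) (fun h => hz _)⟩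
  have sq' : CommSq (matchingLift (p := 𝟙 M) (F.latchingMap α ≫ u) u (Category.comp_id _)) i
      (matchingMap (p := 𝟙 M) (q := 𝟙 M') p p rfl)
      (matchingLift (p := 𝟙 M') (G.latchingMap α ≫ w) w (Category.comp_id _)) := ⟨by
    ext γ n x
    have e (y : (F.obj α).X n) : p.f n (u.f n y) = w.f n ((i.app α).f n y) :=
      congr(($(sq.w)).f n y)
    have e' (h : γ ≤ α) : p.f n (u.f n (F.res (homOfLE h) n x)) =
        w.f n (G.res (homOfLE h) n ((i.app γ).f n x)) := by
      rw [e, app_res]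
    refine matching_ext (p := 𝟙 M')
      (x := matchingXMap (p := 𝟙 M) (q := 𝟙 M') p p rfl γ n
        (matchingXLift (p := 𝟙 M) (F.latchingMap α ≫ u) u (Category.comp_id _) γ n x))
      (y := matchingXLift (p := 𝟙 M') (G.latchingMap α ≫ w) w (Category.comp_id _) γ n
        ((i.app γ).f n x)) (fun h => ?_) e'
    change p.f n (u.f n ((F.latchingMap α).f n (F.latchingι h n x))) =
      w.f n ((G.latchingMap α).f n (G.latchingι h n ((i.app γ).f n x)))
    rw [latchingMap_latchingι, latchingMap_latchingι, e' h.le]⟩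
  have := hi _ hq
  obtain ⟨l, hl₁, hl₂⟩ : ∃ l, i ≫ l = _ ∧ l ≫ _ = _ := ⟨sq'.lift, sq'.fac_left, sq'.fac_right⟩
  refine ⟨⟨{ l := ofMatching (𝟙 M) l, fac_left := ?_, fac_right := ?_ }⟩⟩
  · ext n x
    refine congr(matchingSnd (p := 𝟙 M) ((Hom.app $hl₁ α).f n x) le_rfl).trans ?_
    exact congrArg (u.f n) (res_id F α n x)
  · ext n y
    refine congr(matchingSnd (p := 𝟙 M') ((Hom.app $hl₂ α).f n y) le_rfl).trans ?_
    exact congrArg (w.f n) (res_id G α n y)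

end
end DiagMod

namespace DiagMod

/-! ### Assembling the model structure -/

section

variable {N : Type u} [PartialOrder N] {A : N ⥤ CommRingCat.{u}}

instance : (weq A).HasTwoOutOfThreeProperty where
  comp_mem f g hf hg α := by
    have := hf α
    have := hg α
    exact quasiIso_comp (f.app α) (g.app α)
  of_postcomp f g hg hfg α := by
    have := hg α
    have : QuasiIso (f.app α ≫ g.app α) := hfg α
    exact quasiIso_of_comp_right (f.app α) (g.app α)
  of_precomp f g hf hfg α := by
    have := hf α
    have : QuasiIso (f.app α ≫ g.app α) := hfg α
    exact quasiIso_of_comp_left (f.app α) (g.app α)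

instance hasFunctorialFactorization_llp_fib :
    (fib A).llp.HasFunctorialFactorization (fib A) := by
  rw [← genTrivCof_rlp]
  infer_instance

instance hasFunctorialFactorization_llp_fib_inf_weq :
    (fib A ⊓ weq A).llp.HasFunctorialFactorization (fib A ⊓ weq A) := by
  rw [← genCof_rlp]
  infer_instance

/-- Retract argument: factor `φ` as a map lifting against fibrations followed by a fibration. By
two-out-of-three the second factor is a trivial fibration, so `φ` lifts against it and is a retract
of the first factor. -/
lemma llp_inf_weq : (fib A ⊓ weq A).llp ⊓ weq A = (fib A).llp := by
  apply le_antisymm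
  · rintro F G φ ⟨hφ, hφ'⟩
    have h := MorphismProperty.factorizationData (fib A).llp (fib A) φ
    have hp : (fib A ⊓ weq A) h.p := ⟨h.hp, (weq A).of_precomp h.i h.p
      (llp_fib_le_weq _ h.hi) (by rwa [h.fac])⟩
    have := hφ _ hp
    exact MorphismProperty.of_retract (RetractArrow.ofLeftLiftingProperty h.fac) h.hi
  · exact le_inf (MorphismProperty.antitone_llp inf_le_left) llp_fib_le_weq

/-- The fibrations of the model structure. -/
abbrev categoryWithFibrations : CategoryWithFibrations (DiagMod A) := ⟨fib A⟩

/-- The weak equivalences of the model structure. -/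
abbrev categoryWithWeakEquivalences : CategoryWithWeakEquivalences (DiagMod A) := ⟨weq A⟩

/-- The cofibrations of the model structure. -/
abbrev categoryWithCofibrations : CategoryWithCofibrations (DiagMod A) := ⟨(fib A ⊓ weq A).llp⟩

attribute [local instance] categoryWithFibrations categoryWithWeakEquivalences
  categoryWithCofibrations

lemma fibrations_eq : fibrations (DiagMod A) = fib A := rfl

lemma weakEquivalences_eq : weakEquivalences (DiagMod A) = weq A := rfl

lemma cofibrations_eq : cofibrations (DiagMod A) = (fib A ⊓ weq A).llp := rfl

lemma trivialFibrations_eq : trivialFibrations (DiagMod A) = fib A ⊓ weq A := rfl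

lemma trivialCofibrations_eq : trivialCofibrations (DiagMod A) = (fib A).llp := llp_inf_weq

instance : (weakEquivalences (DiagMod A)).HasTwoOutOfThreeProperty := by
  rw [weakEquivalences_eq]
  infer_instance

/-- The left class is a left orthogonal by definition; the right class is the right orthogonal of
the generators, hence is recovered from its own left orthogonal. -/
instance : (cofibrations (DiagMod A)).IsWeakFactorizationSystem
    (trivialFibrations (DiagMod A)) := by
  rw [cofibrations_eq, trivialFibrations_eq]
  exact { rlp := by rw [← genCof_rlp, MorphismProperty.rlp_llp_rlp], llp := rfl }

instance : (trivialCofibrations (DiagMod A)).IsWeakFactorizationSystem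
    (fibrations (DiagMod A)) := by
  rw [trivialCofibrations_eq, fibrations_eq]
  exact { rlp := by rw [← genTrivCof_rlp, MorphismProperty.rlp_llp_rlp], llp := rfl }

lemma weakEquivalence_iff_quasiIso {F G : DiagMod A} (φ : F ⟶ G) :
    WeakEquivalence φ ↔ ∀ α, QuasiIso (φ.app α) :=
  weakEquivalence_iff φ

lemma fibration_iff_surjective {F G : DiagMod A} (φ : F ⟶ G) :
    Fibration φ ↔ ∀ (α : N) (n : ℤ), Function.Surjective ((φ.app α).f n) :=
  fibration_iff φ

lemma cofibration_iff_relLatchingMap [WellFoundedLT N] {F G : DiagMod A} (φ : F ⟶ G) :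
    Cofibration φ ↔ ∀ α, DGMod.cof _ (relLatchingMap φ α) :=
  (cofibration_iff φ).trans ⟨relLatchingMap_of_llp φ, llp_of_relLatchingMap φ⟩

lemma hasFunctorialFactorization_trivialCofibrations :
    (trivialCofibrations (DiagMod A)).HasFunctorialFactorization (fibrations (DiagMod A)) := by
  rw [trivialCofibrations_eq, fibrations_eq]
  infer_instance

lemma hasFunctorialFactorization_cofibrations :
    (cofibrations (DiagMod A)).HasFunctorialFactorization (trivialFibrations (DiagMod A)) :=
  hasFunctorialFactorization_llp_fib_inf_weq

variable (A) in
/-- The model structure in which weak equivalences and fibrations are defined indexwise. -/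
abbrev modelCategory : ModelCategory (DiagMod A) := ModelCategory.mk' _

end

end DiagMod

end

theorem theorem3p9 {X : Scheme.{u}} [IsNoetherian X] [X.IsSeparated]
    (hdim : topologicalKrullDim X < ⊤) {H : Type u} (U : H → X.Opens)
    (hU : ∀ h, IsAffineOpen (U h)) (hcover : ⨆ h, U h = ⊤) :
    HasLimits (DiagMod (coverDiagram U)) ∧ HasColimits (DiagMod (coverDiagram U)) ∧
    ∃ _ : ModelCategory (DiagMod (coverDiagram U)),
      (∀ {F G : DiagMod (coverDiagram U)} (φ : F ⟶ G),
        WeakEquivalence φ ↔ ∀ α : CoverNerve U, QuasiIso (φ.app α)) ∧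
      (∀ {F G : DiagMod (coverDiagram U)} (φ : F ⟶ G),
        Fibration φ ↔ ∀ (α : CoverNerve U) (n : ℤ), Function.Surjective ((φ.app α).f n)) ∧
      (∀ {F G : DiagMod (coverDiagram U)} (φ : F ⟶ G),
        Cofibration φ ↔
          ∀ α : CoverNerve U, DGMod.cof ((coverDiagram U).obj α) (DiagMod.relLatchingMap φ α)) ∧
      (trivialCofibrations (DiagMod (coverDiagram U))).HasFunctorialFactorization
        (fibrations (DiagMod (coverDiagram U))) ∧
      (cofibrations (DiagMod (coverDiagram U))).HasFunctorialFactorization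
        (trivialFibrations (DiagMod (coverDiagram U))) := by
  -- The cofibration criterion needs inclusion on the nerve to be well founded, which instance
  -- search derives from the finiteness of its elements.
  exact ⟨inferInstance, inferInstance, DiagMod.modelCategory (coverDiagram U),
    DiagMod.weakEquivalence_iff_quasiIso, DiagMod.fibration_iff_surjective,
    DiagMod.cofibration_iff_relLatchingMap,
    DiagMod.hasFunctorialFactorization_trivialCofibrations,
    DiagMod.hasFunctorialFactorization_cofibrations⟩
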